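/- Let $n\ge 1$ and let $\mathcal N=\mathbb R\times\mathbb C^n$ be the $(2n+1)$-dimensional Heisenberg group with group law $(t,z)(s,w)=(t+s-\operatorname{Im}({}^t\bar z w),\,z+w)$, a simply connected nilpotent Lie group. Equip it with the contact form $\omega_0=dt+\operatorname{Im}({}^t\bar z\,dz)$ and with the complex structure $J$ on $\ker\omega_0$ that is the horizontal lift of multiplication by $i$ on $\mathbb C^n$. Terminology: a pseudo-Hermitian structure $\{\omega,J\}$ on a smooth manifold consists of a contact form $\omega$ and a complex structure $J$ ($J^2=-1$) on the bundle $\ker\omega$ such that the Levi form $d\omega\circ J=d\omega(\cdot,J\cdot)$ is symmetric and positive definite on $\ker\omega$; its metric is $\omega\cdot\omega+d\omega\circ J$, where $J$ is extended by $0$ on the Reeb field. It is standard if the Reeb field generates a one-parameter group of diffeomorphisms preserving $\omega$ and $J$. A Sasaki structure is a standard pseudo-Hermitian structure for which the CR structure $(\ker\omega,J)$ is integrable; it is compatible with a Riemannian metric $g$ if $g=\omega\cdot\omega+d\omega\circ J$. Then $\{\omega_0,J\}$ is a Sasaki structure on $\mathcal N$; let $g_0=\omega_0\cdot\omega_0+d\omega_0\circ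 J$ be its Sasaki metric. The map $\tau(t,z)=(-t,\bar z)$ is an automorphism of $\mathcal N$ of order two with $\tau^*\omega_0=-\omega_0$ and $\tau_*J=-J\tau_*$ on $\ker\omega_0$. Let $\Lambda=\mathbb Z\times(\mathbb Z^n+i\mathbb Z^n)\le\mathcal N$, let $\mu=\alpha_{1/2}\,\tau$ with $\alpha_{1/2}=(0,(\tfrac12,0,\dots,0))$, and let $\pi=\langle\mu,\Lambda\rangle\le\mathcal N\rtimes\langle\tau\rangle$. Then: 1. $\pi$ is torsion-free, contains $\Lambda$ as a subgroup of index $2$, and acts freely and properly discontinuously on $\mathcal N$, and the quotient $\pi\backslash\mathcal N$ is a compact (Hausdorff, smooth) infra-nilmanifold for which the projection $\mathcal N\to\pi\backslash\mathcal N$ is a local diffeomorphism. 2. The Sasaki metric $g_0$ induces a Riemannian metric $\hat g_0$ on $\pi\backslash\mathcal N$ for which the projection $(\mathcal N,g_0)\to(\pi\backslash\mathcal N,\hat g_0)$ is a local isometry; so $\hat g_0$ is locally a Sasaki metric. 3. $(\pi\backslash\mathcal N,\hat g_0)$ admits no compatible Sasaki structure; in fact there is no standard pseudo-Hermitian structure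 $\{\hat\eta,\hat J\}$, integrable or not, on $\pi\backslash\mathcal N$ with $\hat g_0=\hat\eta\cdot\hat\eta+d\hat\eta\circ\hat J$. -/

import Mathlib

open scoped Manifold ContDiff ComplexConjugate

noncomputable section

/-! ### Pseudo-Hermitian and Sasaki structures on smooth manifolds -/

namespace SasakiGeometry

section Manifold

variable {E : Type*} [NormedAddCommGroup E] [NormedSpace ℝ E]
variable {M : Type*} [TopologicalSpace M] [ChartedSpace E M]

/-- The expression in the preferred chart at `x` of a one-form `η` on `M`, i.e. its pull-back under
the inverse of that chart, as a one-form on the model vector space `E`. -/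
def oneFormInChart (η : (x : M) → TangentSpace 𝓘(ℝ, E) x →L[ℝ] ℝ) (x : M) (y : E) : E →L[ℝ] ℝ :=
  (η ((extChartAt 𝓘(ℝ, E) x).symm y)).comp
    (mfderiv 𝓘(ℝ, E) 𝓘(ℝ, E) (extChartAt 𝓘(ℝ, E) x).symm y)

/-- The exterior derivative `dη` of a one-form, computed in the preferred chart at the base point
(normalised by `dη(X, Y) = X (η Y) - Y (η X) - η [X, Y]`). -/
def extDerivOneForm (η : (x : M) → TangentSpace 𝓘(ℝ, E) x →L[ℝ] ℝ) (x : M)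
    (v w : TangentSpace 𝓘(ℝ, E) x) : ℝ :=
  extDeriv (fun y : E => ContinuousAlternatingMap.ofSubsingleton ℝ E ℝ (0 : Fin 1)
      (oneFormInChart η x y)) (extChartAt 𝓘(ℝ, E) x x)
    ![mfderiv 𝓘(ℝ, E) 𝓘(ℝ, E) (extChartAt 𝓘(ℝ, E) x) x v,
      mfderiv 𝓘(ℝ, E) 𝓘(ℝ, E) (extChartAt 𝓘(ℝ, E) x) x w]

/-- `η` is a contact form: it is nowhere zero, and `dη` is non-degenerate on `ker η`. -/
structure IsContactForm (η : (x : M) → TangentSpace 𝓘(ℝ, E) x →L[ℝ] ℝ) : Prop where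
  ne_zero : ∀ x, η x ≠ 0
  nondegenerate : ∀ (x : M) (v : TangentSpace 𝓘(ℝ, E) x), η x v = 0 →
    (∀ w : TangentSpace 𝓘(ℝ, E) x, η x w = 0 → extDerivOneForm η x v w = 0) → v = 0

/-- `h` preserves the pseudo-Hermitian structure: `h^* η = η`, and `h_* J = J h_*` on `ker η`. -/
structure PreservesPsh (η : (x : M) → TangentSpace 𝓘(ℝ, E) x →L[ℝ] ℝ)
    (J : (x : M) → TangentSpace 𝓘(ℝ, E) x →L[ℝ] TangentSpace 𝓘(ℝ, E) x) (h : M → M) : Prop where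
  form : ∀ (x : M) (v : TangentSpace 𝓘(ℝ, E) x),
    η (h x) (mfderiv 𝓘(ℝ, E) 𝓘(ℝ, E) h x v) = η x v
  complex : ∀ (x : M) (v : TangentSpace 𝓘(ℝ, E) x), η x v = 0 →
    mfderiv 𝓘(ℝ, E) 𝓘(ℝ, E) h x (J x v) = J (h x) (mfderiv 𝓘(ℝ, E) 𝓘(ℝ, E) h x v)

/-- `h` is anti-pseudo-Hermitian: `h^* η = -η`, and `h_* J = -J h_*` on `ker η`. -/
structure ReversesPsh (η : (x : M) → TangentSpace 𝓘(ℝ, E) x →L[ℝ] ℝ)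
    (J : (x : M) → TangentSpace 𝓘(ℝ, E) x →L[ℝ] TangentSpace 𝓘(ℝ, E) x) (h : M → M) : Prop where
  form : ∀ (x : M) (v : TangentSpace 𝓘(ℝ, E) x),
    η (h x) (mfderiv 𝓘(ℝ, E) 𝓘(ℝ, E) h x v) = -η x v
  complex : ∀ (x : M) (v : TangentSpace 𝓘(ℝ, E) x), η x v = 0 →
    mfderiv 𝓘(ℝ, E) 𝓘(ℝ, E) h x (J x v) = -J (h x) (mfderiv 𝓘(ℝ, E) 𝓘(ℝ, E) h x v)

variable [IsManifold 𝓘(ℝ, E) ∞ M]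

/-- `{η, J}` is a pseudo-Hermitian structure with Reeb field `A`: `η` is a smooth contact form, `J`
is a smooth complex structure on the bundle `ker η`, and the Levi form `dη ∘ J` is symmetric and
positive definite on `ker η`. As usual, `J` is extended to the whole tangent bundle by `J A = 0`.
Integrability of `J` is the separate condition `IsCRIntegrable`. -/
structure IsPseudoHermitian (η : (x : M) → TangentSpace 𝓘(ℝ, E) x →L[ℝ] ℝ)
    (J : (x : M) → TangentSpace 𝓘(ℝ, E) x →L[ℝ] TangentSpace 𝓘(ℝ, E) x)
    (A : (x : M) → TangentSpace 𝓘(ℝ, E) x) : Prop where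
  smooth_form : ContMDiff 𝓘(ℝ, E) (𝓘(ℝ, E).prod 𝓘(ℝ, E →L[ℝ] ℝ)) ∞
    (fun x => Bundle.TotalSpace.mk' (E →L[ℝ] ℝ)
      (E := fun x : M => TangentSpace 𝓘(ℝ, E) x →L[ℝ] Bundle.Trivial M ℝ x) x (η x))
  smooth_complex : ContMDiff 𝓘(ℝ, E) (𝓘(ℝ, E).prod 𝓘(ℝ, E →L[ℝ] E)) ∞
    (fun x => Bundle.TotalSpace.mk' (E →L[ℝ] E)
      (E := fun x : M => TangentSpace 𝓘(ℝ, E) x →L[ℝ] TangentSpace 𝓘(ℝ, E) x) x (J x))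
  smooth_reeb : ContMDiff 𝓘(ℝ, E) (𝓘(ℝ, E).prod 𝓘(ℝ, E)) ∞
    (fun x => (⟨x, A x⟩ : TangentBundle 𝓘(ℝ, E) M))
  contact : IsContactForm η
  form_reeb : ∀ x, η x (A x) = 1
  extDeriv_reeb : ∀ (x : M) (v : TangentSpace 𝓘(ℝ, E) x), extDerivOneForm η x (A x) v = 0
  complex_reeb : ∀ x, J x (A x) = 0
  form_complex : ∀ (x : M) (v : TangentSpace 𝓘(ℝ, E) x), η x v = 0 → η x (J x v) = 0
  complex_complex : ∀ (x : M) (v : TangentSpace 𝓘(ℝ, E) x), η x v = 0 → J x (J x v) = -v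
  levi_symm : ∀ (x : M) (v w : TangentSpace 𝓘(ℝ, E) x), η x v = 0 → η x w = 0 →
    extDerivOneForm η x v (J x w) = extDerivOneForm η x w (J x v)
  levi_pos : ∀ (x : M) (v : TangentSpace 𝓘(ℝ, E) x), η x v = 0 → v ≠ 0 →
    0 < extDerivOneForm η x v (J x v)

/-- A pseudo-Hermitian structure is standard if its Reeb field generates a (global, smooth)
one-parameter group of pseudo-Hermitian transformations. -/
structure IsStandardPseudoHermitian (η : (x : M) → TangentSpace 𝓘(ℝ, E) x →L[ℝ] ℝ)
    (J : (x : M) → TangentSpace 𝓘(ℝ, E) x →L[ℝ] TangentSpace 𝓘(ℝ, E) x)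
    (A : (x : M) → TangentSpace 𝓘(ℝ, E) x) : Prop extends IsPseudoHermitian η J A where
  flow : ∃ φ : ℝ → M → M,
    ContMDiff (𝓘(ℝ, ℝ).prod 𝓘(ℝ, E)) 𝓘(ℝ, E) ∞ (fun p : ℝ × M => φ p.1 p.2) ∧
    φ 0 = id ∧ (∀ s t, φ (s + t) = φ s ∘ φ t) ∧
    (∀ x, IsMIntegralCurve (I := 𝓘(ℝ, E)) (fun t => φ t x) A) ∧
    ∀ t, PreservesPsh η J (φ t)

/-- Integrability of the CR structure `(ker η, J)`: for vector fields `X`, `Y` tangent to `ker η`,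
`[JX, JY] - [X, Y] = J ([JX, Y] + [X, JY])`. (For a pseudo-Hermitian structure the left-hand side
is tangent to `ker η`, and so is `[JX, Y] + [X, JY]`.) -/
def IsCRIntegrable (η : (x : M) → TangentSpace 𝓘(ℝ, E) x →L[ℝ] ℝ)
    (J : (x : M) → TangentSpace 𝓘(ℝ, E) x →L[ℝ] TangentSpace 𝓘(ℝ, E) x) : Prop :=
  ∀ X Y : (x : M) → TangentSpace 𝓘(ℝ, E) x,
    ContMDiff 𝓘(ℝ, E) (𝓘(ℝ, E).prod 𝓘(ℝ, E)) ∞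
      (fun x => (⟨x, X x⟩ : TangentBundle 𝓘(ℝ, E) M)) →
    ContMDiff 𝓘(ℝ, E) (𝓘(ℝ, E).prod 𝓘(ℝ, E)) ∞
      (fun x => (⟨x, Y x⟩ : TangentBundle 𝓘(ℝ, E) M)) →
    (∀ x, η x (X x) = 0) → (∀ x, η x (Y x) = 0) → ∀ x,
    VectorField.mlieBracket 𝓘(ℝ, E) (fun p => J p (X p)) (fun p => J p (Y p)) x
        - VectorField.mlieBracket 𝓘(ℝ, E) X Y x =
      J x (VectorField.mlieBracket 𝓘(ℝ, E) (fun p => J p (X p)) Y x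
        + VectorField.mlieBracket 𝓘(ℝ, E) X (fun p => J p (Y p)) x)

/-- `{η, J}` is a Sasaki structure with Reeb field (structure field) `A`. -/
structure IsSasaki (η : (x : M) → TangentSpace 𝓘(ℝ, E) x →L[ℝ] ℝ)
    (J : (x : M) → TangentSpace 𝓘(ℝ, E) x →L[ℝ] TangentSpace 𝓘(ℝ, E) x)
    (A : (x : M) → TangentSpace 𝓘(ℝ, E) x) : Prop extends IsStandardPseudoHermitian η J A where
  integrable : IsCRIntegrable η J

variable (E M) in
/-- Smooth Riemannian metrics on `M`. -/
abbrev RiemMetric : Type _ :=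
  Bundle.ContMDiffRiemannianMetric 𝓘(ℝ, E) ∞ E (fun x : M => TangentSpace 𝓘(ℝ, E) x)

/-- `g` is the metric `η · η + dη ∘ J` of `{η, J}`, where `(dη ∘ J)(v, w) = dη(v, J w)`. -/
def IsCompatible (g : RiemMetric E M) (η : (x : M) → TangentSpace 𝓘(ℝ, E) x →L[ℝ] ℝ)
    (J : (x : M) → TangentSpace 𝓘(ℝ, E) x →L[ℝ] TangentSpace 𝓘(ℝ, E) x) : Prop :=
  ∀ (x : M) (v w : TangentSpace 𝓘(ℝ, E) x),
    g.inner x v w = η x v * η x w + extDerivOneForm η x v (J x w)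

end Manifold

end SasakiGeometry

/-! ### The Heisenberg group -/

/-- The underlying space `ℝ × ℂⁿ` of the Heisenberg group, a real vector space of dimension
`2n + 1`; it serves as its own model space as a smooth manifold. -/
def Heis (n : ℕ) : Type := ℝ × (Fin n → ℂ)

namespace Heis

variable {n : ℕ}

instance : NormedAddCommGroup (Heis n) := inferInstanceAs (NormedAddCommGroup (ℝ × (Fin n → ℂ)))
instance : NormedSpace ℝ (Heis n) := inferInstanceAs (NormedSpace ℝ (ℝ × (Fin n → ℂ)))
instance : FiniteDimensional ℝ (Heis n) :=
  inferInstanceAs (FiniteDimensional ℝ (ℝ × (Fin n → ℂ)))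
instance : LocallyCompactSpace (Heis n) :=
  inferInstanceAs (LocallyCompactSpace (ℝ × (Fin n → ℂ)))

/-- The element `(t, z)`. -/
def mk (t : ℝ) (z : Fin n → ℂ) : Heis n := (t, z)
/-- The central coordinate `t` of `(t, z)`. -/
def t (x : Heis n) : ℝ := Prod.fst x
/-- The complex coordinates `z` of `(t, z)`. -/
def z (x : Heis n) : Fin n → ℂ := Prod.snd x

@[ext] theorem ext {x y : Heis n} (h₁ : x.t = y.t) (h₂ : x.z = y.z) : x = y := Prod.ext h₁ h₂
@[simp] theorem t_mk (t : ℝ) (z : Fin n → ℂ) : (mk t z).t = t := rfl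
@[simp] theorem z_mk (t : ℝ) (z : Fin n → ℂ) : (mk t z).z = z := rfl

/-- The real bilinear form `Im (ᵗz̄ w)` on `ℂⁿ`. -/
def imForm (z w : Fin n → ℂ) : ℝ := (∑ i, conj (z i) * w i).im

theorem imForm_add_left (a b c : Fin n → ℂ) : imForm (a + b) c = imForm a c + imForm b c := by
  simp [imForm, add_mul, Finset.sum_add_distrib]

theorem imForm_add_right (a b c : Fin n → ℂ) : imForm a (b + c) = imForm a b + imForm a c := by
  simp [imForm, mul_add, Finset.sum_add_distrib]

theorem imForm_neg_left (a c : Fin n → ℂ) : imForm (-a) c = -imForm a c := by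
  simp [imForm]

theorem imForm_self (a : Fin n → ℂ) : imForm a a = 0 := by
  simp only [imForm, Complex.im_sum]
  exact Finset.sum_eq_zero fun i _ => by simp [Complex.mul_im]; ring

theorem imForm_conj (a b : Fin n → ℂ) :
    imForm (fun i => conj (a i)) (fun i => conj (b i)) = -imForm a b := by
  simp only [imForm, Complex.im_sum, ← Finset.sum_neg_distrib]
  exact Finset.sum_congr rfl fun i _ => by simp [Complex.mul_im]; ring

instance : Mul (Heis n) := ⟨fun x y => mk (x.t + y.t - imForm x.z y.z) (x.z + y.z)⟩
instance : One (Heis n) := ⟨mk 0 0⟩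
instance : Inv (Heis n) := ⟨fun x => mk (-x.t) (-x.z)⟩

@[simp] theorem t_mul (x y : Heis n) : (x * y).t = x.t + y.t - imForm x.z y.z := rfl
@[simp] theorem z_mul (x y : Heis n) : (x * y).z = x.z + y.z := rfl
@[simp] theorem t_one : (1 : Heis n).t = 0 := rfl
@[simp] theorem z_one : (1 : Heis n).z = 0 := rfl
@[simp] theorem t_inv (x : Heis n) : (x⁻¹).t = -x.t := rfl
@[simp] theorem z_inv (x : Heis n) : (x⁻¹).z = -x.z := rfl

/-- The Heisenberg group law `(t, z)(s, w) = (t + s - Im (ᵗz̄ w), z + w)`. -/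
instance : Group (Heis n) :=
  Group.ofLeftAxioms
    (fun a b c => by
      ext1
      · simp only [t_mul, z_mul, imForm_add_left, imForm_add_right]; ring
      · simp only [z_mul, add_assoc])
    (fun a => by
      ext1
      · simp [imForm]
      · simp)
    (fun a => by
      ext1
      · simp [imForm_neg_left, imForm_self]
      · simp)

/-- The linear map `v ↦ v_t + Im (ᵗz̄ v_z)` for the point `x = (t, z)`. -/
def formCLM (x : Heis n) : Heis n →L[ℝ] ℝ :=
  LinearMap.toContinuousLinearMap
    { toFun := fun v => v.t + imForm x.z v.z
      map_add' := fun v w => by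
        change (v.t + w.t) + imForm x.z (v.z + w.z) = _
        rw [imForm_add_right]; ring
      map_smul' := fun c v => by
        change c * v.t + imForm x.z (c • v.z) = c * (v.t + imForm x.z v.z)
        have : imForm x.z (c • v.z) = c * imForm x.z v.z := by
          simp only [imForm, Complex.im_sum, Finset.mul_sum]
          exact Finset.sum_congr rfl fun i _ => by simp [Complex.mul_im]; ring
        rw [this]; ring }

/-- The contact form `ω₀ = dt + Im (ᵗz̄ dz)`. -/
def form (x : Heis n) : TangentSpace 𝓘(ℝ, Heis n) x →L[ℝ] ℝ := formCLM x

/-- The linear map `v ↦ (-Im (ᵗz̄ i v_z), i v_z)` for the point `x = (t, z)`. -/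
def complexCLM (x : Heis n) : Heis n →L[ℝ] Heis n :=
  LinearMap.toContinuousLinearMap
    { toFun := fun v => mk (-imForm x.z (Complex.I • v.z)) (Complex.I • v.z)
      map_add' := fun v w => by
        ext1
        · change -imForm x.z (Complex.I • (v.z + w.z)) =
            -imForm x.z (Complex.I • v.z) + -imForm x.z (Complex.I • w.z)
          rw [smul_add, imForm_add_right]; ring
        · change Complex.I • (v.z + w.z) = Complex.I • v.z + Complex.I • w.z
          rw [smul_add]
      map_smul' := fun c v => by
        ext1
        · change -imForm x.z (Complex.I • (c • v.z)) = c * -imForm x.z (Complex.I • v.z)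
          simp only [imForm, Complex.im_sum, Finset.mul_sum, ← Finset.sum_neg_distrib]
          exact Finset.sum_congr rfl fun i _ => by simp [Complex.mul_im]; ring
        · change Complex.I • (c • v.z) = c • (Complex.I • v.z)
          rw [smul_comm] }

/-- The complex structure `J` on `ker ω₀`: the horizontal lift of multiplication by `i` on `ℂⁿ`,
i.e. `J v` is the vector in `ker ω₀` with complex coordinates `i v_z` (so `J ∂_t = 0`). -/
def complexStr (x : Heis n) : TangentSpace 𝓘(ℝ, Heis n) x →L[ℝ] TangentSpace 𝓘(ℝ, Heis n) x :=
  complexCLM x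

/-- The Reeb field `∂_t` of `ω₀`. -/
def reeb (x : Heis n) : TangentSpace 𝓘(ℝ, Heis n) x := mk (n := n) 1 0

/-! ### The group `π` and the quotient `π \ N` -/

variable (n) in
/-- The automorphism `τ(t, z) = (-t, z̄)` of the Heisenberg group. -/
def tau : MulAut (Heis n) where
  toFun x := mk (-x.t) (fun i => conj (x.z i))
  invFun x := mk (-x.t) (fun i => conj (x.z i))
  left_inv x := by ext <;> simp
  right_inv x := by ext <;> simp
  map_mul' x y := by
    ext1
    · simp only [t_mk, t_mul, z_mk, imForm_conj]; ring
    · funext i; simp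

variable (n) in
/-- The group `N ⋊ Aut(N)` of affine transformations of the Heisenberg group `N`. -/
abbrev Aff : Type := Heis n ⋊[MonoidHom.id (MulAut (Heis n))] MulAut (Heis n)

/-- The affine transformation `(a, f)` acts by `x ↦ a * f x`. -/
instance : MulAction (Aff n) (Heis n) where
  smul γ x := γ.left * γ.right x
  one_smul x := by
    change (1 : Aff n).left * (1 : Aff n).right x = x
    simp
  mul_smul γ δ x := by
    change (γ * δ).left * (γ * δ).right x = γ.left * γ.right (δ.left * δ.right x)
    simp [mul_assoc]

variable (n) in
/-- The integral lattice `Λ = ℤ × (ℤⁿ + i ℤⁿ)`. -/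
def lattice : Subgroup (Heis n) where
  carrier := {x | (∃ a : ℤ, x.t = a) ∧
    ∀ i, (∃ b : ℤ, (x.z i).re = b) ∧ ∃ c : ℤ, (x.z i).im = c}
  one_mem' := ⟨⟨0, by simp⟩, fun i => ⟨⟨0, by simp⟩, ⟨0, by simp⟩⟩⟩
  inv_mem' := by
    rintro x ⟨⟨a, ha⟩, h⟩
    refine ⟨⟨-a, by simp [ha]⟩, fun i => ?_⟩
    obtain ⟨⟨b, hb⟩, ⟨c, hc⟩⟩ := h i
    exact ⟨⟨-b, by simp [hb]⟩, ⟨-c, by simp [hc]⟩⟩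
  mul_mem' := by
    rintro x y ⟨⟨a, ha⟩, hx⟩ ⟨⟨a', ha'⟩, hy⟩
    choose b hb using fun i => (hx i).1
    choose c hc using fun i => (hx i).2
    choose b' hb' using fun i => (hy i).1
    choose c' hc' using fun i => (hy i).2
    refine ⟨⟨a + a' - ∑ i, (b i * c' i - c i * b' i), ?_⟩, fun i =>
      ⟨⟨b i + b' i, by simp [hb, hb']⟩, ⟨c i + c' i, by simp [hc, hc']⟩⟩⟩
    simp only [t_mul, imForm, Complex.im_sum, ha, ha']
    push_cast
    congr 1
    exact Finset.sum_congr rfl fun i _ => by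
      simp [Complex.mul_im, hb, hc, hb', hc']; ring

variable (n) in
/-- The element `α_s = (0, (s, 0, …, 0))`. -/
def alpha (s : ℝ) : Heis n := mk 0 (fun i => if (i : ℕ) = 0 then (s : ℂ) else 0)

variable (n) in
/-- The element `μ = α_{1/2} τ` of `N ⋊ ⟨τ⟩`. -/
def mu : Aff n := SemidirectProduct.inl (alpha n (1 / 2)) * SemidirectProduct.inr (tau n)

variable (n) in
/-- The lattice `Λ`, as a group of left translations in `N ⋊ Aut(N)`. -/
def latticeAff : Subgroup (Aff n) := (lattice n).map SemidirectProduct.inl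

variable (n) in
/-- The group `π = ⟨μ, Λ⟩`. -/
def piGroup : Subgroup (Aff n) := Subgroup.closure ({mu n} ∪ (latticeAff n : Set (Aff n)))

variable (n) in
/-- The quotient `π \ N`, with the quotient topology. -/
abbrev InfraNil : Type := MulAction.orbitRel.Quotient (piGroup n) (Heis n)

variable (n) in
/-- The projection `N → π \ N`. -/
def proj (x : Heis n) : InfraNil n := Quotient.mk _ x

end Heis

end

/-! Suppose a standard pseudo-Hermitian structure on $\pi\backslash\mathcal N$ has metric $\hat
g_0$. Its Reeb flow preserves $\hat\eta$ and $\hat J$, hence also $d\hat\eta$ and $\hat g_0$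
(`inner_flow`), so the Reeb field is a Killing field. It lifts to a Killing field $V$ of $g_0$ on
$\mathcal N$ that is invariant under $\pi$ (`killing_of_isometries`; only local lifts of the flow
are needed). The heart of the proof is `killing_eq_zero`: such a $V$ vanishes, whereas $\hat\eta$
takes the value $1$ on the Reeb field.

To see that $V=0$, put $f=\omega_0(V)$ and let $\zeta$ be the $\mathbb C^n$-component of $V$.
Evaluated on vertical and horizontal pairs, the Killing equation says that $f$ does not depend on
$t$, that $df(u)=-2\operatorname{Im}({}^t\bar\zeta
u)-2\operatorname{Re}({}^t\overline{\partial_t\zeta}\,u)$ for horizontal lifts, and that the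
horizontal derivative of $\zeta$ is skew. The second equation makes $\partial_t\zeta+i\zeta$
constant along central lines. Non-constant solutions of this equation have minimal period $2\pi$,
but the centre of $\Lambda$ imposes period $1$; so $\zeta$ does not depend on $t$. Skewness and
$\Lambda$-invariance then make $\zeta$ constant, so $f$ is affine in $z$ with linear part
$-2\operatorname{Im}({}^t\bar\zeta\,\cdot)$. Since $f$ is $\Lambda$-invariant, $\zeta=0$ and $f$ is
constant. Finally $\mu$ reverses $\omega_0$ and preserves $V$, so $f=-f=0$. Integrability of $\hat
J$ plays no part.

The geometry of the quotient rests on two facts. Conjugation by $\alpha_{1/2}$ preserves $\Lambda$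
(`conj_mem_lattice`), which gives $\pi=\Lambda\cup\alpha_{1/2}\Lambda\tau$ (`piGroup_cases`).
Elements of the second coset move $\operatorname{Re}z_0$ by a half-integer (`re_alpha_mul_ne_zero`),
which gives both freeness and torsion-freeness. Since $\tau$ only changes the sign of $\omega_0$,
and $g_0$ is quadratic in $\omega_0$, the metric descends (`metricCLM_smul`). -/

noncomputable section

/-! ### Quotients of a vector space by a free, properly discontinuous, smooth action -/

namespace SmoothQuotient

open MulAction Topology

section Projection

variable {E : Type*} {G : Type*} [Group G] [MulAction G E]

variable (G) in
/-- The projection onto the orbit space. -/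
def mk (x : E) : orbitRel.Quotient G E := Quotient.mk _ x

theorem mk_smul (g : G) (x : E) : mk G (g • x) = mk G x :=
  Quotient.sound ⟨g, rfl⟩

theorem exists_smul_eq {x y : E} (h : mk G x = mk G y) : ∃ g : G, g • x = y :=
  let ⟨g, hg⟩ := Quotient.exact h.symm
  ⟨g, hg⟩

theorem continuous_mk [TopologicalSpace E] : Continuous (mk G : E → _) := continuous_quotient_mk'

end Projection

variable {E : Type*} [NormedAddCommGroup E] [NormedSpace ℝ E] [LocallyCompactSpace E]
  {G : Type*} [Group G] [MulAction G E] [ProperlyDiscontinuousSMul G E]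
  [ContinuousConstSMul G E] [IsCancelSMul G E]

-- The charts of the orbit space are local inverses of the covering projection, and the model chart
-- is the identity. So all inverse charts are one global map, which is why transition maps turn out
-- to be group elements.
omit [NormedSpace ℝ E] in
theorem atlas_symm {e : OpenPartialHomeomorph (orbitRel.Quotient G E) E}
    (he : e ∈ atlas E (orbitRel.Quotient G E)) : ⇑e.symm = mk G := by
  obtain ⟨q, rfl⟩ := he
  funext x
  simp only [chartAt_self_eq, OpenPartialHomeomorph.trans_refl]
  simp [mk]

omit [NormedSpace ℝ E] in
theorem chartAt_symm (p : orbitRel.Quotient G E) : ⇑(chartAt E p).symm = mk G :=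
  atlas_symm (chart_mem_atlas E p)

omit [NormedSpace ℝ E] in
theorem atlas_mk {e : OpenPartialHomeomorph (orbitRel.Quotient G E) E}
    (he : e ∈ atlas E (orbitRel.Quotient G E)) {y : E} (hy : y ∈ e.target) : e (mk G y) = y := by
  rw [← atlas_symm he]; exact e.right_inv hy

omit [NormedSpace ℝ E] in
theorem mk_atlas {e : OpenPartialHomeomorph (orbitRel.Quotient G E) E}
    (he : e ∈ atlas E (orbitRel.Quotient G E)) {p : orbitRel.Quotient G E} (hp : p ∈ e.source) :
    mk G (e p) = p := by
  rw [← atlas_symm he]; exact e.left_inv hp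

omit [NormedSpace ℝ E] in
/-- Near `x`, the projection followed by a chart is the action of a group element. -/
theorem exists_chart_mk_eventuallyEq {e : OpenPartialHomeomorph (orbitRel.Quotient G E) E}
    (he : e ∈ atlas E (orbitRel.Quotient G E)) {x : E} (hx : mk G x ∈ e.source) :
    ∃ g : G, g • x = e (mk G x) ∧ (fun y => e (mk G y)) =ᶠ[𝓝 x] fun y => g • y := by
  obtain ⟨g, hg⟩ := exists_smul_eq (mk_atlas he hx).symm
  refine ⟨g, hg, ?_⟩
  have h1 : g • x ∈ e.target := hg ▸ e.map_source hx
  filter_upwards [(continuous_const_smul g).continuousAt.preimage_mem_nhds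
    (e.open_target.mem_nhds h1)] with y hy
  rw [← mk_smul g y, atlas_mk he hy]

variable (G E) in
/-- The action is by smooth maps. -/
def IsSmoothAction : Prop := ∀ g : G, ContDiff ℝ ∞ (fun x : E => g • x)

variable (hG : IsSmoothAction E G)
include hG

/-- Each transition map is the projection followed by a chart, hence locally the action of one group
element. -/
theorem isManifold : IsManifold 𝓘(ℝ, E) ∞ (orbitRel.Quotient G E) := by
  refine isManifold_of_contDiffOn _ _ _ fun e e' he he' => ?_
  rintro y ⟨hy, -⟩
  simp only [modelWithCornersSelf_coe_symm, Set.preimage_id_eq, id_eq,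
    OpenPartialHomeomorph.trans_source, OpenPartialHomeomorph.symm_source, Set.mem_inter_iff,
    Set.mem_preimage, atlas_symm he] at hy
  obtain ⟨g, -, hg⟩ := exists_chart_mk_eventuallyEq he' hy.2
  refine (ContDiffAt.congr_of_eventuallyEq ((hG g).contDiffAt) ?_).contDiffWithinAt
  filter_upwards [hg] with z hz
  simpa [atlas_symm he] using hz

/-- The diffeomorphism given by a group element. -/
def smulDiffeo (g : G) : Diffeomorph 𝓘(ℝ, E) 𝓘(ℝ, E) E E ∞ where
  toEquiv := MulAction.toPerm g
  contMDiff_toFun := (hG g).contMDiff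
  contMDiff_invFun := (hG g⁻¹).contMDiff

theorem isLocalDiffeomorph_mk :
    IsLocalDiffeomorph 𝓘(ℝ, E) 𝓘(ℝ, E) ∞ (mk G : E → orbitRel.Quotient G E) := by
  intro x
  have := isManifold hG
  set e := chartAt E (mk G x)
  have he : e ∈ atlas E (orbitRel.Quotient G E) := chart_mem_atlas _ _
  have hx : mk G x ∈ e.source := mem_chart_source _ _
  obtain ⟨g, hg, -⟩ := exists_chart_mk_eventuallyEq he hx
  -- The inverse chart is a local diffeomorphism only on its target, so `x` is first moved there by
  -- `g`; the composite is again the projection because orbits are unchanged.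
  have h1 : IsLocalDiffeomorphAt 𝓘(ℝ, E) 𝓘(ℝ, E) ∞ (e.symm : E → _) (g • x) :=
    ⟨{ toPartialEquiv := e.symm.toPartialEquiv
       open_source := e.open_target
       open_target := e.open_source
       contMDiffOn_toFun := contMDiffOn_chart_symm
       contMDiffOn_invFun := contMDiffOn_chart }, hg ▸ e.map_source hx, fun _ _ => rfl⟩
  have h2 := h1.comp (hf := (smulDiffeo hG g).isLocalDiffeomorph x)
  convert h2 using 1
  funext y
  change mk G y = e.symm (g • y)
  rw [atlas_symm he, mk_smul]

-- The tangent space of the quotient at an orbit is identified with `E` through the preferred chart,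
-- that is, at the representative which the chart selects. In this identification the differential
-- of the projection is that of the group element moving `x` to this representative.
omit hG in
theorem exists_mfderiv_mk [IsManifold 𝓘(ℝ, E) ∞ (orbitRel.Quotient G E)]
    (hG : IsSmoothAction E G) (x : E) :
    ∃ g : G, g • x = chartAt E (mk G x) (mk G x) ∧
      (mfderiv 𝓘(ℝ, E) 𝓘(ℝ, E) (mk G) x : E →L[ℝ] E) = fderiv ℝ (fun y => g • y) x := by
  obtain ⟨g, hg, h⟩ := exists_chart_mk_eventuallyEq (chart_mem_atlas E (mk G x))
    (mem_chart_source E (mk G x))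
  refine ⟨g, hg, ?_⟩
  refine HasMFDerivAt.mfderiv ⟨continuous_mk.continuousAt, ?_⟩
  exact ((((hG g).differentiable (by simp)).differentiableAt.hasFDerivAt).congr_of_eventuallyEq
    h).hasFDerivWithinAt

/-- The chain rule for `mk G ∘ g = mk G`; it makes lifts of vector fields from the quotient
equivariant. -/
theorem mfderiv_mk_smul [IsManifold 𝓘(ℝ, E) ∞ (orbitRel.Quotient G E)] (g : G) (x v : E) :
    mfderiv 𝓘(ℝ, E) 𝓘(ℝ, E) (mk G) (g • x) (fderiv ℝ (fun y => g • y) x v) =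
      mfderiv 𝓘(ℝ, E) 𝓘(ℝ, E) (mk G) x v := by
  have hm := (isLocalDiffeomorph_mk hG).mdifferentiable (by simp)
  have h := mfderiv_comp (I := 𝓘(ℝ, E)) (I' := 𝓘(ℝ, E)) (I'' := 𝓘(ℝ, E)) x (hm (g • x))
    ((hG g).contMDiff.mdifferentiable (by simp) x)
  have h' : (mk G ∘ fun y : E => g • y) = mk G := funext fun y => mk_smul g y
  rw [h', mfderiv_eq_fderiv] at h
  exact (DFunLike.congr_fun h v).symm

end SmoothQuotient

/-! ### Naturality of the exterior derivative of one-forms -/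

namespace SasakiGeometry

open Topology

section Naturality

variable {E : Type*} [NormedAddCommGroup E] [NormedSpace ℝ E]
  {M : Type*} [TopologicalSpace M] [ChartedSpace E M] [IsManifold 𝓘(ℝ, E) ∞ M]

/-- The differential of a map between manifolds modelled on `E`, as an endomorphism of `E`. -/
def modelDeriv {M : Type*} [TopologicalSpace M] [ChartedSpace E M]
    {N : Type*} [TopologicalSpace N] [ChartedSpace E N] (f : M → N) (x : M) : E →L[ℝ] E :=
  mfderiv 𝓘(ℝ, E) 𝓘(ℝ, E) f x

theorem modelDeriv_comp {M N P : Type*} [TopologicalSpace M] [ChartedSpace E M]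
    [TopologicalSpace N] [ChartedSpace E N] [TopologicalSpace P] [ChartedSpace E P]
    {f : M → N} {g : N → P} {x : M} (hg : MDifferentiableAt 𝓘(ℝ, E) 𝓘(ℝ, E) g (f x))
    (hf : MDifferentiableAt 𝓘(ℝ, E) 𝓘(ℝ, E) f x) :
    modelDeriv (E := E) (g ∘ f) x = (modelDeriv g (f x)).comp (modelDeriv f x) :=
  mfderiv_comp x hg hf

theorem modelDeriv_congr {M N : Type*} [TopologicalSpace M] [ChartedSpace E M]
    [TopologicalSpace N] [ChartedSpace E N] {f g : M → N} {x : M} (h : f =ᶠ[𝓝 x] g) :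
    modelDeriv (E := E) f x = modelDeriv g x :=
  DFunLike.ext _ _ fun v => by
    have := h.mfderiv_eq (I := 𝓘(ℝ, E)) (I' := 𝓘(ℝ, E))
    exact DFunLike.congr_fun this v

theorem modelDeriv_eq_fderiv (f : E → E) (x : E) : modelDeriv f x = fderiv ℝ f x :=
  mfderiv_eq_fderiv

theorem symmL_trivializationAt_eq_modelDeriv {p x : M} (hx : x ∈ (chartAt E p).source) :
    ((trivializationAt E (TangentSpace 𝓘(ℝ, E)) p).symmL ℝ x : E →L[ℝ] E) =
      modelDeriv (extChartAt 𝓘(ℝ, E) p).symm (extChartAt 𝓘(ℝ, E) p x) := by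
  rw [TangentBundle.symmL_trivializationAt hx]
  simp only [modelWithCornersSelf_coe, Set.range_id, mfderivWithin_univ]
  rfl

/-- The tangent trivialisation at `p` is inverted by the differential of the inverse chart, so the
bundle coordinates of `η`, composed with the inverse chart, are its chart expression. -/
theorem contDiffAt_oneFormInChart {η : (x : M) → TangentSpace 𝓘(ℝ, E) x →L[ℝ] ℝ}
    (hη : ContMDiff 𝓘(ℝ, E) (𝓘(ℝ, E).prod 𝓘(ℝ, E →L[ℝ] ℝ)) ∞
      (fun x => Bundle.TotalSpace.mk' (E →L[ℝ] ℝ)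
        (E := fun x : M => TangentSpace 𝓘(ℝ, E) x →L[ℝ] Bundle.Trivial M ℝ x) x (η x))) (p : M) :
    ContDiffAt ℝ ∞ (oneFormInChart η p) (extChartAt 𝓘(ℝ, E) p p) := by
  have h := ((contMDiffAt_hom_bundle _).1 (hη p)).2
  have hs : ContMDiffAt 𝓘(ℝ, E) 𝓘(ℝ, E) ∞ (extChartAt 𝓘(ℝ, E) p).symm
      (extChartAt 𝓘(ℝ, E) p p) := by
    have := contMDiffWithinAt_extChartAt_symm_range_self (I := 𝓘(ℝ, E)) (n := ∞) p
    rwa [modelWithCornersSelf_coe, Set.range_id, contMDiffWithinAt_univ] at this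
  have hp : (extChartAt 𝓘(ℝ, E) p).symm (extChartAt 𝓘(ℝ, E) p p) = p := extChartAt_to_inv p
  rw [← hp] at h
  have h2 := (ContMDiffAt.comp _ h hs).contDiffAt
  rw [hp] at h2
  refine h2.congr_of_eventuallyEq ?_
  filter_upwards [extChartAt_target_mem_nhds (I := 𝓘(ℝ, E)) p] with y hy
  have hy' : (extChartAt 𝓘(ℝ, E) p).symm y ∈ (chartAt E p).source := by
    simpa using (extChartAt 𝓘(ℝ, E) p).map_target hy
  have h3 := symmL_trivializationAt_eq_modelDeriv hy'
  rw [(extChartAt 𝓘(ℝ, E) p).right_inv hy] at h3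
  refine DFunLike.ext _ _ fun v => ?_
  simp only [Function.comp_apply, ContinuousLinearMap.inCoordinates]
  have h4 : (trivializationAt ℝ (Bundle.Trivial M ℝ) p).continuousLinearMapAt ℝ
      ((extChartAt 𝓘(ℝ, E) p).symm y) = ContinuousLinearMap.id ℝ ℝ :=
    Bundle.Trivial.continuousLinearMapAt_trivialization ℝ M ℝ _
  rw [h4]
  exact congrArg (fun T : E →L[ℝ] E => η ((extChartAt 𝓘(ℝ, E) p).symm y) (T v)) h3.symm

/-- The pull-back of a one-form along a map from the model space. -/
def pullbackForm (η : (x : M) → TangentSpace 𝓘(ℝ, E) x →L[ℝ] ℝ) (q : E → M) (y : E) : E →L[ℝ] ℝ :=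
  (η (q y)).comp (mfderiv 𝓘(ℝ, E) 𝓘(ℝ, E) q y)

/-- Since `extDerivOneForm` uses a different chart at each point, values at different points are
compared by pulling back to the model space, where $d$ commutes with pull-back along `c ∘ q`. -/
theorem extDerivOneForm_mfderiv {η : (x : M) → TangentSpace 𝓘(ℝ, E) x →L[ℝ] ℝ}
    (hη : ContMDiff 𝓘(ℝ, E) (𝓘(ℝ, E).prod 𝓘(ℝ, E →L[ℝ] ℝ)) ∞
      (fun x => Bundle.TotalSpace.mk' (E →L[ℝ] ℝ)
        (E := fun x : M => TangentSpace 𝓘(ℝ, E) x →L[ℝ] Bundle.Trivial M ℝ x) x (η x)))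
    {q : E → M} (hq : ContMDiff 𝓘(ℝ, E) 𝓘(ℝ, E) ∞ q) (x v w : E) :
    extDerivOneForm η (q x) (mfderiv 𝓘(ℝ, E) 𝓘(ℝ, E) q x v) (mfderiv 𝓘(ℝ, E) 𝓘(ℝ, E) q x w) =
      extDeriv (fun y => ContinuousAlternatingMap.ofSubsingleton ℝ E ℝ (0 : Fin 1)
        (pullbackForm η q y)) x ![v, w] := by
  set p := q x
  have hqd := hq.mdifferentiable (by simp)
  set c := extChartAt 𝓘(ℝ, E) p with hc
  set f : E → E := c ∘ q
  have hfx : ContMDiffAt 𝓘(ℝ, E) 𝓘(ℝ, E) ∞ f x := contMDiffAt_extChartAt.comp x (hq x)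
  have hf : ContDiffAt ℝ ∞ f x := hfx.contDiffAt
  have hω : DifferentiableAt ℝ (fun y => ContinuousAlternatingMap.ofSubsingleton ℝ E ℝ (0 : Fin 1)
      (oneFormInChart η p y)) (f x) := by
    have h1 := (contDiffAt_oneFormInChart hη p).differentiableAt (by simp)
    have := (ContinuousAlternatingMap.ofSubsingletonLIE (𝕜 := ℝ) (E := E) (F := ℝ) (0 : Fin 1)).differentiable
      (oneFormInChart η p (f x))
    exact this.comp (f x) h1
  have hpb := extDeriv_pullback hω hf (by simpa using ENat.LEInfty.out)
  have hev : (fun y => ContinuousAlternatingMap.ofSubsingleton ℝ E ℝ (0 : Fin 1)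
        (pullbackForm η q y)) =ᶠ[𝓝 x] fun y => (ContinuousAlternatingMap.ofSubsingleton ℝ E ℝ
          (0 : Fin 1) (oneFormInChart η p (f y))).compContinuousLinearMap (fderiv ℝ f y) := by
    have hsrc : q ⁻¹' c.source ∈ 𝓝 x :=
      hq.continuous.continuousAt.preimage_mem_nhds (extChartAt_source_mem_nhds p)
    -- Equality of derivatives at `y` needs `q = c.symm ∘ f` on a whole neighbourhood of `y`, not
    -- only at `y`.
    filter_upwards [eventually_eventually_nhds.2 hsrc] with y hy
    have hys : q y ∈ c.source := hy.self_of_nhds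
    have hsy : c.symm (f y) = q y := c.left_inv hys
    have hsd : MDifferentiableAt 𝓘(ℝ, E) 𝓘(ℝ, E) c.symm (f y) := by
      have := (contMDiffOn_extChartAt_symm (I := 𝓘(ℝ, E)) (n := ∞) p)
      exact (this.contMDiffAt ((isOpen_extChartAt_target p).mem_nhds
        (c.map_source hys))).mdifferentiableAt (by simp)
    have hcd : MDifferentiableAt 𝓘(ℝ, E) 𝓘(ℝ, E) c (q y) :=
      (contMDiffAt_extChartAt' (n := ∞) (by simpa [hc] using hys)).mdifferentiableAt (by simp)
    have hfy : MDifferentiableAt 𝓘(ℝ, E) 𝓘(ℝ, E) f y := hcd.comp y (hqd y)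
    have hd : modelDeriv (E := E) q y = (modelDeriv c.symm (f y)).comp (fderiv ℝ f y) := by
      rw [← modelDeriv_eq_fderiv, ← modelDeriv_comp hsd hfy]
      apply modelDeriv_congr
      filter_upwards [hy] with z hz
      exact (c.left_inv hz).symm
    ext u
    let η' : M → E →L[ℝ] ℝ := η
    change η' (q y) (modelDeriv q y (u 0)) = η' (c.symm (f y)) (modelDeriv c.symm (f y)
      (fderiv ℝ f y (u 0)))
    rw [hd, hsy]
    rfl
  rw [hev.extDeriv_eq, hpb]
  have hcd : MDifferentiableAt 𝓘(ℝ, E) 𝓘(ℝ, E) c (q x) :=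
      (contMDiffAt_extChartAt (n := ∞)).mdifferentiableAt (by simp)
  have hd : fderiv ℝ f x = (modelDeriv c (q x)).comp (modelDeriv q x) := by
    rw [← modelDeriv_eq_fderiv, ← modelDeriv_comp hcd (hqd x)]
  rw [ContinuousAlternatingMap.compContinuousLinearMap_apply, hd]
  unfold extDerivOneForm
  congr 1
  funext i
  fin_cases i <;> rfl

end Naturality

/-! ### The Reeb flow acts by isometries -/

section Flow

variable {E : Type*} [NormedAddCommGroup E] [NormedSpace ℝ E]
  {M : Type*} [TopologicalSpace M] [ChartedSpace E M] [IsManifold 𝓘(ℝ, E) ∞ M]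
  {η : (x : M) → TangentSpace 𝓘(ℝ, E) x →L[ℝ] ℝ}
  {J : (x : M) → TangentSpace 𝓘(ℝ, E) x →L[ℝ] TangentSpace 𝓘(ℝ, E) x}
  {A : (x : M) → TangentSpace 𝓘(ℝ, E) x}

omit [IsManifold 𝓘(ℝ, E) ∞ M] in
/-- A curve which factors through `f` has velocity the image under the differential of `f`. -/
theorem modelDeriv_apply_velocity {N : Type*} [TopologicalSpace N] [ChartedSpace E N]
    {f : N → M} {c : ℝ → N} {d : ℝ → M} {s : ℝ} {u w : E}
    (hc : HasMFDerivAt 𝓘(ℝ, ℝ) 𝓘(ℝ, E) c s ((1 : ℝ →L[ℝ] ℝ).smulRight u))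
    (hd : HasMFDerivAt 𝓘(ℝ, ℝ) 𝓘(ℝ, E) d s ((1 : ℝ →L[ℝ] ℝ).smulRight w))
    (hf : MDifferentiableAt 𝓘(ℝ, E) 𝓘(ℝ, E) f (c s)) (h : f ∘ c =ᶠ[𝓝 s] d) :
    modelDeriv f (c s) u = w := by
  have h1 := hf.hasMFDerivAt.comp s hc
  have h2 := hasMFDerivAt_unique (h1.congr_of_eventuallyEq h.symm) hd
  have h3 := DFunLike.congr_fun h2 (1 : ℝ)
  have h4 : modelDeriv f (c s) ((1 : ℝ) • u) = (1 : ℝ) • w := h3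
  simpa using h4

-- The maps of a one-parameter group commute, so `φ s` carries the orbit of `p` to the orbit of `φ s
-- p`; compare velocities at time zero.
omit [IsManifold 𝓘(ℝ, E) ∞ M] in
theorem modelDeriv_flow_field {φ : ℝ → M → M}
    (hφ : ContMDiff (𝓘(ℝ, ℝ).prod 𝓘(ℝ, E)) 𝓘(ℝ, E) ∞ (fun p : ℝ × M => φ p.1 p.2))
    (h0 : φ 0 = id) (hadd : ∀ s t, φ (s + t) = φ s ∘ φ t)
    (hA : ∀ x, IsMIntegralCurve (I := 𝓘(ℝ, E)) (fun t => φ t x) A) (s : ℝ) (p : M) :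
    mfderiv 𝓘(ℝ, E) 𝓘(ℝ, E) (φ s) p (A p) = A (φ s p) := by
  have hs : ContMDiff 𝓘(ℝ, E) 𝓘(ℝ, E) ∞ (φ s) :=
    hφ.comp (contMDiff_const.prodMk contMDiff_id)
  let A' : M → E := A
  have h1 : HasMFDerivAt 𝓘(ℝ, ℝ) 𝓘(ℝ, E) (fun t => φ t p) 0
    ((1 : ℝ →L[ℝ] ℝ).smulRight (A' (φ 0 p))) := hA p 0
  have h2 : HasMFDerivAt 𝓘(ℝ, ℝ) 𝓘(ℝ, E) (fun t => φ t (φ s p)) 0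
    ((1 : ℝ →L[ℝ] ℝ).smulRight (A' (φ 0 (φ s p)))) := hA (φ s p) 0
  have h3 := modelDeriv_apply_velocity h1 h2 (hs.mdifferentiable (by simp) _)
    (Filter.Eventually.of_forall fun t => by
      change (φ s ∘ φ t) p = (φ t ∘ φ s) p
      rw [← hadd, ← hadd, add_comm])
  simp only [h0, id_eq] at h3
  exact h3

/-- The Reeb flow of a standard pseudo-Hermitian structure acts by isometries of its metric. -/
theorem inner_flow (hS : IsPseudoHermitian η J A) {g : RiemMetric E M} (hg : IsCompatible g η J)
    {φ : ℝ → M → M}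
    (hφ : ContMDiff (𝓘(ℝ, ℝ).prod 𝓘(ℝ, E)) 𝓘(ℝ, E) ∞ (fun p : ℝ × M => φ p.1 p.2))
    (h0 : φ 0 = id) (hadd : ∀ s t, φ (s + t) = φ s ∘ φ t)
    (hA : ∀ x, IsMIntegralCurve (I := 𝓘(ℝ, E)) (fun t => φ t x) A)
    (hP : ∀ t, PreservesPsh η J (φ t)) {q : E → M} (hq : IsLocalDiffeomorph 𝓘(ℝ, E) 𝓘(ℝ, E) ∞ q)
    (s : ℝ) (x v w : E) :
    g.inner (φ s (q x)) (mfderiv 𝓘(ℝ, E) 𝓘(ℝ, E) (φ s ∘ q) x v)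
        (mfderiv 𝓘(ℝ, E) 𝓘(ℝ, E) (φ s ∘ q) x w) =
      g.inner (q x) (mfderiv 𝓘(ℝ, E) 𝓘(ℝ, E) q x v) (mfderiv 𝓘(ℝ, E) 𝓘(ℝ, E) q x w) := by
  have hs : ContMDiff 𝓘(ℝ, E) 𝓘(ℝ, E) ∞ (φ s) :=
    hφ.comp (contMDiff_const.prodMk contMDiff_id)
  have hsd := hs.mdifferentiable (by simp)
  have hqd := hq.contMDiff.mdifferentiable (by simp)
  have hcomp : ∀ y u, mfderiv 𝓘(ℝ, E) 𝓘(ℝ, E) (φ s ∘ q) y u =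
      mfderiv 𝓘(ℝ, E) 𝓘(ℝ, E) (φ s) (q y) (mfderiv 𝓘(ℝ, E) 𝓘(ℝ, E) q y u) := fun y u => by
    rw [mfderiv_comp y (hsd _) (hqd _)]; rfl
  have hpb : pullbackForm η (φ s ∘ q) = pullbackForm η q := by
    funext y
    refine DFunLike.ext _ _ fun u => ?_
    refine Eq.trans ?_ ((hP s).form (q y) (mfderiv 𝓘(ℝ, E) 𝓘(ℝ, E) q y u))
    exact congrArg _ (hcomp y u)
  set b := mfderiv 𝓘(ℝ, E) 𝓘(ℝ, E) q x w with hb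
  -- The flow is assumed to commute with `J` only on `ker η`. The Reeb component of `b` is harmless:
  -- `J` kills it, and the flow maps `A` to `A`, which `J` kills again.
  set b' := b - η (q x) b • A (q x) with hb'
  have hb0 : η (q x) b' = 0 := by simp [hb', hS.form_reeb]
  have hJ : J (q x) b = J (q x) b' := by simp [hb', hS.complex_reeb]
  have hJ' : J (φ s (q x)) (mfderiv 𝓘(ℝ, E) 𝓘(ℝ, E) (φ s) (q x) b) =
      mfderiv 𝓘(ℝ, E) 𝓘(ℝ, E) (φ s) (q x) (J (q x) b') := by
    rw [(hP s).complex (q x) b' hb0, hb', map_sub, map_smul, map_sub, map_smul,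
      modelDeriv_flow_field hφ h0 hadd hA, hS.complex_reeb, smul_zero, sub_zero]
  -- Both arguments of `dη` must come from the model space for the pull-back formula to apply; here
  -- the differential of `q` must be surjective.
  obtain ⟨u, hu⟩ : ∃ u : E, mfderiv 𝓘(ℝ, E) 𝓘(ℝ, E) q x u = J (q x) b' :=
    (hq.mfderivToContinuousLinearEquiv (by simp) x).surjective _
  have hform : ∀ u : E, η (φ s (q x)) (mfderiv 𝓘(ℝ, E) 𝓘(ℝ, E) (φ s ∘ q) x u) =
      η (q x) (mfderiv 𝓘(ℝ, E) 𝓘(ℝ, E) q x u) :=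
    fun u => DFunLike.congr_fun (congrFun hpb x) u
  have hext := extDerivOneForm_mfderiv hS.smooth_form (hs.comp hq.contMDiff) x v u
  rw [hpb, ← extDerivOneForm_mfderiv hS.smooth_form hq.contMDiff] at hext
  have hJu : J (φ s (q x)) (mfderiv 𝓘(ℝ, E) 𝓘(ℝ, E) (φ s ∘ q) x w) =
      mfderiv 𝓘(ℝ, E) 𝓘(ℝ, E) (φ s ∘ q) x u := by
    rw [hcomp x u, hu, ← hJ', hb]; exact congrArg _ (hcomp x w)
  refine (hg _ _ _).trans (Eq.trans ?_ (hg _ _ _).symm)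
  refine congrArg₂ (· + ·) (congrArg₂ (· * ·) (hform v) (hform w)) ?_
  refine (congrArg _ hJu).trans (hext.trans (congrArg _ ?_))
  rw [hu, hJ]

end Flow

/-! ### Local lifts of the flow and the Killing equation -/

section Killing

variable {E : Type*} [NormedAddCommGroup E] [NormedSpace ℝ E]
  {M : Type*} [TopologicalSpace M] [ChartedSpace E M] [IsManifold 𝓘(ℝ, E) ∞ M]
  {A : (x : M) → TangentSpace 𝓘(ℝ, E) x}

omit [IsManifold 𝓘(ℝ, E) ∞ M] in
/-- The lift to `E` of a smooth family `φ` of maps of `M`, near `(0, x₀)`. -/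
theorem exists_local_lift {q : E → M} (hq : IsLocalDiffeomorph 𝓘(ℝ, E) 𝓘(ℝ, E) ∞ q)
    {φ : ℝ → M → M}
    (hφ : ContMDiff (𝓘(ℝ, ℝ).prod 𝓘(ℝ, E)) 𝓘(ℝ, E) ∞ (fun p : ℝ × M => φ p.1 p.2))
    (h0 : φ 0 = id) (x₀ : E) :
    ∃ ψ : ℝ × E → E, (∀ᶠ p in 𝓝 ((0 : ℝ), x₀), ContDiffAt ℝ ∞ ψ p ∧ q (ψ p) = φ p.1 (q p.2)) ∧
      ∀ᶠ x in 𝓝 x₀, ψ (0, x) = x := by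
  let σ := (hq x₀).localInverse
  refine ⟨fun p => σ (φ p.1 (q p.2)), ?_, ?_⟩
  · have hm : ContMDiff (𝓘(ℝ, ℝ).prod 𝓘(ℝ, E)) 𝓘(ℝ, E) ∞ (fun p : ℝ × E => φ p.1 (q p.2)) :=
      hφ.comp (contMDiff_fst.prodMk (hq.contMDiff.comp contMDiff_snd))
    have hsrc : (fun p : ℝ × E => φ p.1 (q p.2)) ⁻¹' σ.source ∈ 𝓝 ((0 : ℝ), x₀) := by
      refine hm.continuous.continuousAt.preimage_mem_nhds (σ.open_source.mem_nhds ?_)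
      simpa [h0] using (hq x₀).localInverse_mem_source
    filter_upwards [hsrc] with p hp
    refine ⟨?_, (hq x₀).localInverse_right_inv hp⟩
    have h1 : ContMDiffAt 𝓘(ℝ, E) 𝓘(ℝ, E) ∞ σ (φ p.1 (q p.2)) :=
      (hq x₀).contmdiffOn_localInverse.contMDiffAt (σ.open_source.mem_nhds hp)
    have h2 := ContMDiffAt.comp p h1 (hm p)
    rw [← modelWithCornersSelf_prod, chartedSpaceSelf_prod] at h2
    exact h2.contDiffAt
  · filter_upwards [(hq x₀).localInverse_eventuallyEq_left] with x hx
    simpa [h0] using hx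

/-- The lift of the generator of a one-parameter family of isometries satisfies the
Killing equation. -/
theorem killing_of_isometries {q : E → M} (hq : IsLocalDiffeomorph 𝓘(ℝ, E) 𝓘(ℝ, E) ∞ q)
    {φ : ℝ → M → M}
    (hφ : ContMDiff (𝓘(ℝ, ℝ).prod 𝓘(ℝ, E)) 𝓘(ℝ, E) ∞ (fun p : ℝ × M => φ p.1 p.2))
    (h0 : φ 0 = id) (hA : ∀ x, IsMIntegralCurve (I := 𝓘(ℝ, E)) (fun t => φ t x) A)
    {g : RiemMetric E M}
    (hiso : ∀ (s : ℝ) (x v w : E), g.inner (φ s (q x)) (mfderiv 𝓘(ℝ, E) 𝓘(ℝ, E) (φ s ∘ q) x v)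
        (mfderiv 𝓘(ℝ, E) 𝓘(ℝ, E) (φ s ∘ q) x w) =
      g.inner (q x) (mfderiv 𝓘(ℝ, E) 𝓘(ℝ, E) q x v) (mfderiv 𝓘(ℝ, E) 𝓘(ℝ, E) q x w))
    {g₀ : E → E →L[ℝ] E →L[ℝ] ℝ} (hg₀ : Differentiable ℝ g₀)
    (hg : ∀ x v w : E, g.inner (q x) (mfderiv 𝓘(ℝ, E) 𝓘(ℝ, E) q x v)
      (mfderiv 𝓘(ℝ, E) 𝓘(ℝ, E) q x w) = g₀ x v w)
    {V : E → E} (hV : ∀ x : E, mfderiv 𝓘(ℝ, E) 𝓘(ℝ, E) q x (V x) = A (q x)) :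
    Differentiable ℝ V ∧ ∀ x v w : E,
      fderiv ℝ g₀ x (V x) v w + g₀ x (fderiv ℝ V x v) w + g₀ x v (fderiv ℝ V x w) = 0 := by
  rw [Differentiable, ← forall_and]
  intro x₀
  obtain ⟨ψ, hψ, hψ0⟩ := exists_local_lift hq hφ h0 x₀
  have hqd := hq.contMDiff.mdifferentiable (by simp)
  let A' : M → E := A
  let g' : M → E →L[ℝ] E →L[ℝ] ℝ := g.inner
  -- The curve `s ↦ ψ (s, x)` lifts the integral curve of `A` through `q x`, so its initial velocity
  -- has the same image as `V x` under the injective differential of `q`. In particular `V` inherits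
  -- differentiability from `ψ`.
  have hVψ : V =ᶠ[𝓝 x₀] fun x => fderiv ℝ ψ (0, x) (1, 0) := by
    have hc : Filter.Tendsto (fun x : E => ((0 : ℝ), x)) (𝓝 x₀) (𝓝 (0, x₀)) :=
      (Continuous.prodMk_right (0 : ℝ)).tendsto x₀
    filter_upwards [hc.eventually hψ.eventually_nhds, hψ0] with x hx hx0
    have hd : HasDerivAt (fun s : ℝ => ψ (s, x)) (fderiv ℝ ψ (0, x) (1, 0)) 0 := by
      have h1 := (hx.self_of_nhds.1.differentiableAt (by simp)).hasFDerivAt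
      exact h1.comp_hasDerivAt (0 : ℝ) ((hasDerivAt_id (0 : ℝ)).prodMk (hasDerivAt_const _ x))
    have hd' : HasMFDerivAt 𝓘(ℝ, ℝ) 𝓘(ℝ, E) (fun s : ℝ => ψ (s, x)) 0
        ((1 : ℝ →L[ℝ] ℝ).smulRight (fderiv ℝ ψ (0, x) (1, 0))) := hd.hasFDerivAt.hasMFDerivAt
    have h2 : HasMFDerivAt 𝓘(ℝ, ℝ) 𝓘(ℝ, E) (fun t => φ t (q x)) 0
      ((1 : ℝ →L[ℝ] ℝ).smulRight (A' (φ 0 (q x)))) := hA (q x) 0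
    have hc' : Filter.Tendsto (fun s : ℝ => (s, x)) (𝓝 0) (𝓝 (0, x)) :=
      (Continuous.prodMk_left x).tendsto 0
    have h3 := modelDeriv_apply_velocity hd' h2 (hqd _) (by
      filter_upwards [hc'.eventually hx] with s hs using hs.2)
    rw [hx0, h0] at h3
    exact (hq.mfderivToContinuousLinearEquiv (by simp) x).injective ((hV x).trans h3.symm)
  have hψ2 : ContDiffAt ℝ ∞ ψ (0, x₀) := hψ.self_of_nhds.1
  have hD : HasFDerivAt (fderiv ℝ ψ) (fderiv ℝ (fderiv ℝ ψ) (0, x₀)) (0, x₀) :=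
    ((hψ2.fderiv_right (m := 1)
      ((one_add_one_eq_two (R := ℕ∞ω)).le.trans ENat.LEInfty.out)).differentiableAt
      (by simp)).hasFDerivAt
  have hVd : HasFDerivAt V
      ((ContinuousLinearMap.apply ℝ E ((1 : ℝ), (0 : E))).comp
        ((fderiv ℝ (fderiv ℝ ψ) (0, x₀)).comp (ContinuousLinearMap.inr ℝ ℝ E))) x₀ := by
    refine HasFDerivAt.congr_of_eventuallyEq ?_ hVψ
    exact (ContinuousLinearMap.apply ℝ E ((1 : ℝ), (0 : E))).hasFDerivAt.comp x₀
      (hD.comp x₀ (hasFDerivAt_prodMk_right (0 : ℝ) x₀))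
  refine ⟨hVd.differentiableAt, fun v w => ?_⟩
  have hVx : V x₀ = fderiv ℝ ψ (0, x₀) (1, 0) := hVψ.self_of_nhds
  -- Symmetry of mixed partials: the $s$-derivative of $\partial_x\psi$ at $s=0$ is the
  -- $x$-derivative of $\partial_s\psi$, which is $dV$.
  have hsymm := hψ2.isSymmSndFDerivAt (by simpa using ENat.LEInfty.out)
  have hVv : ∀ u : E, fderiv ℝ V x₀ u = fderiv ℝ (fderiv ℝ ψ) (0, x₀) (1, 0) (0, u) := fun u => by
    rw [hVd.fderiv]; exact hsymm _ _
  have hline : HasDerivAt (fun s : ℝ => (s, x₀)) ((1 : ℝ), (0 : E)) 0 :=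
    (hasDerivAt_id (0 : ℝ)).prodMk (hasDerivAt_const _ x₀)
  have hP : HasDerivAt (fun s : ℝ => ψ (s, x₀)) (V x₀) 0 := by
    rw [hVx]
    exact (hψ2.differentiableAt (by simp)).hasFDerivAt.comp_hasDerivAt (0 : ℝ) hline
  have hψx : ψ (0, x₀) = x₀ := hψ0.self_of_nhds
  have ha : ∀ u : E, HasDerivAt (fun s : ℝ => fderiv ℝ ψ (s, x₀) (0, u)) (fderiv ℝ V x₀ u) 0 :=
    fun u => by
      rw [hVv]
      have h1 := hD.comp_hasDerivAt (0 : ℝ) hline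
      simpa using h1.clm_apply (hasDerivAt_const (0 : ℝ) ((0 : ℝ), u))
  have hg1 : HasDerivAt (fun s : ℝ => g₀ (ψ (s, x₀))) (fderiv ℝ g₀ x₀ (V x₀)) 0 := by
    have h1 : HasFDerivAt g₀ (fderiv ℝ g₀ x₀) (ψ (0, x₀)) := by
      rw [hψx]; exact (hg₀ x₀).hasFDerivAt
    exact HasFDerivAt.comp_hasDerivAt (E := E →L[ℝ] E →L[ℝ] ℝ) (0 : ℝ) h1 hP
  have hF := (hg1.clm_apply (ha v)).clm_apply (ha w)
  have hid : fderiv ℝ (fun x => ψ (0, x)) x₀ = ContinuousLinearMap.id ℝ E := by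
    rw [Filter.EventuallyEq.fderiv_eq (f := id) hψ0, fderiv_id]
  have hpart : ∀ᶠ s : ℝ in 𝓝 0, ∀ u, fderiv ℝ ψ (s, x₀) (0, u) =
      fderiv ℝ (fun x => ψ (s, x)) x₀ u := by
    filter_upwards [((Continuous.prodMk_left x₀).tendsto (0 : ℝ)).eventually hψ] with s hs u
    have h1 := (hs.1.differentiableAt (by simp)).hasFDerivAt.comp x₀
      (hasFDerivAt_prodMk_right s x₀)
    rw [show (fun x => ψ (s, x)) = ψ ∘ fun x => (s, x) from rfl, h1.fderiv]
    rfl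
  -- The local lifts $\psi_s$ are isometries of `g₀`. The Killing equation is the $s$-derivative of
  -- this identity at $s=0$.
  have hconst : (fun s : ℝ => g₀ (ψ (s, x₀)) (fderiv ℝ ψ (s, x₀) (0, v))
      (fderiv ℝ ψ (s, x₀) (0, w))) =ᶠ[𝓝 0] fun _ => g₀ x₀ v w := by
    filter_upwards [((Continuous.prodMk_left x₀).tendsto (0 : ℝ)).eventually hψ.eventually_nhds,
      hpart] with s hs hsp
    have hsd : DifferentiableAt ℝ (fun x => ψ (s, x)) x₀ :=
      (hs.self_of_nhds.1.differentiableAt (by simp)).comp x₀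
        (hasFDerivAt_prodMk_right s x₀).differentiableAt
    have hev : q ∘ (fun x => ψ (s, x)) =ᶠ[𝓝 x₀] φ s ∘ q := by
      filter_upwards [((Continuous.prodMk_right s).tendsto x₀).eventually hs] with x hx
      exact hx.2
    have hmd : (modelDeriv q (ψ (s, x₀))).comp (fderiv ℝ (fun x => ψ (s, x)) x₀) =
        modelDeriv (E := E) (φ s ∘ q) x₀ := by
      rw [← modelDeriv_congr hev, ← modelDeriv_eq_fderiv,
        modelDeriv_comp (f := fun x => ψ (s, x)) (hqd _) hsd.mdifferentiableAt]
    have hmd' : ∀ u, modelDeriv q (ψ (s, x₀)) (fderiv ℝ ψ (s, x₀) (0, u)) =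
        modelDeriv (φ s ∘ q) x₀ u := fun u => by rw [hsp, ← hmd]; rfl
    rw [← hg, ← hg, ← hiso s x₀ v w]
    change g' (q (ψ (s, x₀))) (modelDeriv q (ψ (s, x₀)) (fderiv ℝ ψ (s, x₀) (0, v)))
      (modelDeriv q (ψ (s, x₀)) (fderiv ℝ ψ (s, x₀) (0, w))) =
      g' (φ s (q x₀)) (modelDeriv (φ s ∘ q) x₀ v) (modelDeriv (φ s ∘ q) x₀ w)
    rw [hmd', hmd', hs.self_of_nhds.2]
  have h5 := (hF.congr_of_eventuallyEq hconst.symm).unique (hasDerivAt_const (0 : ℝ) (g₀ x₀ v w))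
  have hp0 := hpart.self_of_nhds
  simpa [hψx, hp0, hid] using h5

end Killing

/-! ### Smooth tensor fields -/

section Tensor

variable {E : Type*} [NormedAddCommGroup E] [NormedSpace ℝ E]

theorem symmL_model (b b' : E) :
    ((trivializationAt E (TangentSpace 𝓘(ℝ, E)) b).symmL ℝ b' : E →L[ℝ] E) =
      ContinuousLinearMap.id ℝ E :=
  TangentBundle.symmL_model_space b b'

theorem contMDiff_oneForm {η : E → E →L[ℝ] ℝ} (hη : ContDiff ℝ ∞ η) :
    ContMDiff 𝓘(ℝ, E) (𝓘(ℝ, E).prod 𝓘(ℝ, E →L[ℝ] ℝ)) ∞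
      (fun x => Bundle.TotalSpace.mk' (E →L[ℝ] ℝ)
        (E := fun x : E => TangentSpace 𝓘(ℝ, E) x →L[ℝ] Bundle.Trivial E ℝ x) x (η x)) := by
  intro p
  refine (contMDiffAt_hom_bundle _).2 ⟨contMDiffAt_id, ?_⟩
  refine hη.contMDiff.contMDiffAt.congr_of_eventuallyEq (Filter.Eventually.of_forall fun x => ?_)
  refine DFunLike.ext _ _ fun v => ?_
  have h4 : (trivializationAt ℝ (Bundle.Trivial E ℝ) p).continuousLinearMapAt ℝ x =
      ContinuousLinearMap.id ℝ ℝ :=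
    Bundle.Trivial.continuousLinearMapAt_trivialization ℝ E ℝ _
  simp only [ContinuousLinearMap.inCoordinates]
  rw [h4]
  exact congrArg (fun T : E →L[ℝ] E => η x (T v)) (symmL_model p x)

theorem contMDiff_endomorphism {J : E → E →L[ℝ] E} (hJ : ContDiff ℝ ∞ J) :
    ContMDiff 𝓘(ℝ, E) (𝓘(ℝ, E).prod 𝓘(ℝ, E →L[ℝ] E)) ∞
    (fun x => Bundle.TotalSpace.mk' (E →L[ℝ] E)
      (E := fun x : E => TangentSpace 𝓘(ℝ, E) x →L[ℝ] TangentSpace 𝓘(ℝ, E) x) x (J x)) := by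
  intro p
  refine (contMDiffAt_hom_bundle _).2 ⟨contMDiffAt_id, ?_⟩
  refine hJ.contMDiff.contMDiffAt.congr_of_eventuallyEq (Filter.Eventually.of_forall fun x => ?_)
  exact inCoordinates_tangent_bundle_core_model_space p x p x (J x)

variable {M : Type*} [TopologicalSpace M] [ChartedSpace E M] [IsManifold 𝓘(ℝ, E) ∞ M]

/-- A field of bilinear forms is smooth if its expressions in the charts are. -/
theorem contMDiffAt_bilinear {g : (x : M) → TangentSpace 𝓘(ℝ, E) x →L[ℝ]
      TangentSpace 𝓘(ℝ, E) x →L[ℝ] ℝ} {g₀ : E → E →L[ℝ] E →L[ℝ] ℝ} (hg₀ : ContDiff ℝ ∞ g₀) (p : M)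
    (h : ∀ y ∈ (extChartAt 𝓘(ℝ, E) p).target, ∀ v w : E,
      g ((extChartAt 𝓘(ℝ, E) p).symm y)
        (mfderiv 𝓘(ℝ, E) 𝓘(ℝ, E) (extChartAt 𝓘(ℝ, E) p).symm y v)
        (mfderiv 𝓘(ℝ, E) 𝓘(ℝ, E) (extChartAt 𝓘(ℝ, E) p).symm y w) = g₀ y v w) :
    ContMDiffAt 𝓘(ℝ, E) (𝓘(ℝ, E).prod 𝓘(ℝ, E →L[ℝ] E →L[ℝ] ℝ)) ∞
      (fun b ↦ Bundle.TotalSpace.mk' (E →L[ℝ] E →L[ℝ] ℝ)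
        (E := fun x : M => TangentSpace 𝓘(ℝ, E) x →L[ℝ] TangentSpace 𝓘(ℝ, E) x →L[ℝ] ℝ)
        b (g b)) p := by
  refine (contMDiffAt_hom_bundle _).2 ⟨contMDiffAt_id, ?_⟩
  have hs : ContMDiffAt 𝓘(ℝ, E) 𝓘(ℝ, E →L[ℝ] E →L[ℝ] ℝ) ∞
      (fun x => g₀ (extChartAt 𝓘(ℝ, E) p x)) p :=
    hg₀.contMDiff.contMDiffAt.comp p contMDiffAt_extChartAt
  refine hs.congr_of_eventuallyEq ?_
  filter_upwards [extChartAt_source_mem_nhds (I := 𝓘(ℝ, E)) p] with x hx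
  refine DFunLike.ext _ _ fun v => DFunLike.ext _ _ fun w => ?_
  have hx' : x ∈ (chartAt E p).source := by simpa using hx
  have hsy := symmL_trivializationAt_eq_modelDeriv hx'
  have h4 : (trivializationAt ℝ (Bundle.Trivial M ℝ) p).continuousLinearMapAt ℝ x =
      ContinuousLinearMap.id ℝ ℝ :=
    Bundle.Trivial.continuousLinearMapAt_trivialization ℝ M ℝ _
  let g' : M → E →L[ℝ] E →L[ℝ] ℝ := g
  have h5 : g₀ (extChartAt 𝓘(ℝ, E) p x) v w = g' x
      (modelDeriv (extChartAt 𝓘(ℝ, E) p).symm (extChartAt 𝓘(ℝ, E) p x) v)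
      (modelDeriv (extChartAt 𝓘(ℝ, E) p).symm (extChartAt 𝓘(ℝ, E) p x) w) := by
    have h6 : _ = g' ((extChartAt 𝓘(ℝ, E) p).symm (extChartAt 𝓘(ℝ, E) p x)) _ _ :=
      (h _ ((extChartAt 𝓘(ℝ, E) p).map_source hx) v w).symm
    rw [(extChartAt 𝓘(ℝ, E) p).left_inv hx] at h6
    exact h6
  rw [h5, ← hsy]
  simp only [ContinuousLinearMap.inCoordinates]
  have hmem : x ∈ (trivializationAt (E →L[ℝ] ℝ)
      (fun b : M => TangentSpace 𝓘(ℝ, E) b →L[ℝ] Bundle.Trivial M ℝ b) p).baseSet := by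
    rw [hom_trivializationAt_baseSet]; exact ⟨hx', trivial⟩
  -- A bilinear form is a section of a nested Hom bundle; the inner trivialisation acts by
  -- precomposition with the tangent coordinates, so both arguments end up in the chart.
  have h7 : ∀ ξ : TangentSpace 𝓘(ℝ, E) x →L[ℝ] Bundle.Trivial M ℝ x,
      (trivializationAt (E →L[ℝ] ℝ)
        (fun b : M => TangentSpace 𝓘(ℝ, E) b →L[ℝ] Bundle.Trivial M ℝ b) p).continuousLinearMapAt
          ℝ x ξ = ((trivializationAt ℝ (Bundle.Trivial M ℝ) p).continuousLinearMapAt ℝ x).comp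
            (ξ.comp ((trivializationAt E (TangentSpace 𝓘(ℝ, E)) p).symmL ℝ x)) := fun ξ =>
    congrFun (Bundle.Trivialization.coe_linearMapAt_of_mem _ hmem) ξ
  rw [h4] at h7
  exact DFunLike.congr_fun (h7 (g x
    ((trivializationAt E (TangentSpace 𝓘(ℝ, E)) p).symmL ℝ x v))) w

theorem oneFormInChart_model (η : E → E →L[ℝ] ℝ) (x y : E) : oneFormInChart (M := E) η x y = η y := by
  refine DFunLike.ext _ _ fun v => ?_
  change η y (modelDeriv (id : E → E) y v) = η y v
  rw [modelDeriv_eq_fderiv, fderiv_id]; rfl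

theorem extDerivOneForm_model {η : E → E →L[ℝ] ℝ} {x : E} (hη : DifferentiableAt ℝ η x) (v w : E) :
    extDerivOneForm (M := E) η x v w = fderiv ℝ η x v w - fderiv ℝ η x w v := by
  have h1 : DifferentiableAt ℝ (fun y => ContinuousAlternatingMap.ofSubsingleton ℝ E ℝ (0 : Fin 1)
      (η y)) x :=
    ((ContinuousAlternatingMap.ofSubsingletonLIE (𝕜 := ℝ) (E := E) (F := ℝ)
      (0 : Fin 1)).differentiable (η x)).comp x hη
  have h2 : extDerivOneForm (M := E) η x v w = extDeriv (fun y =>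
      ContinuousAlternatingMap.ofSubsingleton ℝ E ℝ (0 : Fin 1) (η y)) x ![v, w] := by
    unfold extDerivOneForm
    simp only [oneFormInChart_model]
    congr 1
    funext i
    have h3 : ∀ u : E, modelDeriv (id : E → E) x u = u := fun u => by
      rw [modelDeriv_eq_fderiv, fderiv_id]; rfl
    fin_cases i
    · exact h3 v
    · exact h3 w
  have h3 : ∀ u u' : E, fderiv ℝ (fun y => η y u) x u' = fderiv ℝ η x u' u := fun u u' => by
    rw [fderiv_clm_apply hη (differentiableAt_const u)]; simp
  rw [h2, extDeriv_apply h1]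
  simp only [ContinuousAlternatingMap.ofSubsingleton_apply_apply]
  refine (Fin.sum_univ_two _).trans ?_
  have e0 : (0 : Fin 2).removeNth ![v, w] 0 = w := rfl
  have e1 : (1 : Fin 2).removeNth ![v, w] 0 = v := rfl
  rw [e0, e1, h3, h3]
  simp [sub_eq_add_neg]

end Tensor

end SasakiGeometry

/-! ### The Sasaki structure of the Heisenberg group -/

namespace Heis

open SasakiGeometry Topology

variable {n : ℕ}

/-- The real inner product `Re (ᵗz̄ w)` on `ℂⁿ`. -/
def reForm (z w : Fin n → ℂ) : ℝ := (∑ i, conj (z i) * w i).re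

theorem imForm_eq_sum (z w : Fin n → ℂ) :
    imForm z w = ∑ i, ((z i).re * (w i).im - (z i).im * (w i).re) := by
  simp only [imForm, Complex.im_sum]
  exact Finset.sum_congr rfl fun i _ => by simp [Complex.mul_im]; ring

theorem reForm_eq_sum (z w : Fin n → ℂ) :
    reForm z w = ∑ i, ((z i).re * (w i).re + (z i).im * (w i).im) := by
  simp only [reForm, Complex.re_sum]
  exact Finset.sum_congr rfl fun i _ => by simp [Complex.mul_re]

theorem imForm_swap (z w : Fin n → ℂ) : imForm w z = -imForm z w := by
  simp only [imForm_eq_sum, ← Finset.sum_neg_distrib]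
  exact Finset.sum_congr rfl fun i _ => by ring

theorem reForm_swap (z w : Fin n → ℂ) : reForm w z = reForm z w := by
  simp only [reForm_eq_sum]
  exact Finset.sum_congr rfl fun i _ => by ring

theorem imForm_I_smul_right (z w : Fin n → ℂ) : imForm z (Complex.I • w) = reForm z w := by
  simp only [imForm_eq_sum, reForm_eq_sum]
  exact Finset.sum_congr rfl fun i _ => by simp

theorem imForm_I_smul_left (z w : Fin n → ℂ) : imForm (Complex.I • z) w = -reForm z w := by
  rw [imForm_swap, imForm_I_smul_right, reForm_swap]

theorem imForm_neg_right (z w : Fin n → ℂ) : imForm z (-w) = -imForm z w := by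
  rw [imForm_swap, imForm_neg_left, imForm_swap w z]

theorem imForm_smul_right (c : ℝ) (z w : Fin n → ℂ) : imForm z (c • w) = c * imForm z w := by
  simp only [imForm_eq_sum, Finset.mul_sum]
  exact Finset.sum_congr rfl fun i _ => by simp; ring

theorem imForm_smul_left (c : ℝ) (z w : Fin n → ℂ) : imForm (c • z) w = c * imForm z w := by
  simp only [imForm_eq_sum, Finset.mul_sum]
  exact Finset.sum_congr rfl fun i _ => by simp; ring

theorem reForm_self_pos {z : Fin n → ℂ} (hz : z ≠ 0) : 0 < reForm z z := by
  obtain ⟨i, hi⟩ := Function.ne_iff.1 hz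
  rw [reForm_eq_sum]
  refine Finset.sum_pos' (fun j _ => add_nonneg (mul_self_nonneg _) (mul_self_nonneg _))
    ⟨i, Finset.mem_univ i, ?_⟩
  have := Complex.normSq_pos.2 hi
  rwa [Complex.normSq_apply] at this

/-- `imForm` as a continuous bilinear map. -/
def imFormL (n : ℕ) : (Fin n → ℂ) →L[ℝ] (Fin n → ℂ) →L[ℝ] ℝ :=
  (LinearMap.mk₂ ℝ imForm imForm_add_left (fun c z w => imForm_smul_left c z w)
    imForm_add_right (fun c z w => imForm_smul_right c z w)).toContinuousBilinearMap

@[simp] theorem imFormL_apply (z w : Fin n → ℂ) : imFormL n z w = imForm z w := rfl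

/-- Multiplication by `i` on `ℂⁿ`. -/
def mulI (n : ℕ) : (Fin n → ℂ) →L[ℝ] (Fin n → ℂ) :=
  (Complex.I • ContinuousLinearMap.id ℂ (Fin n → ℂ)).restrictScalars ℝ

@[simp] theorem mulI_apply (z : Fin n → ℂ) : mulI n z = Complex.I • z := rfl

/-- `reForm` as a continuous bilinear map. -/
def reFormL (n : ℕ) : (Fin n → ℂ) →L[ℝ] (Fin n → ℂ) →L[ℝ] ℝ :=
  ((ContinuousLinearMap.compL ℝ (Fin n → ℂ) (Fin n → ℂ) ℝ).flip (mulI n)).comp (imFormL n)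

@[simp] theorem reFormL_apply (z w : Fin n → ℂ) : reFormL n z w = reForm z w :=
  imForm_I_smul_right z w

/-- The coordinate `t`, as a continuous linear map. -/
def tL (n : ℕ) : Heis n →L[ℝ] ℝ := ContinuousLinearMap.fst ℝ ℝ (Fin n → ℂ)
/-- The coordinates `z`, as a continuous linear map. -/
def zL (n : ℕ) : Heis n →L[ℝ] (Fin n → ℂ) := ContinuousLinearMap.snd ℝ ℝ (Fin n → ℂ)
/-- The inclusion of the centre, as a continuous linear map. -/
def inT (n : ℕ) : ℝ →L[ℝ] Heis n := ContinuousLinearMap.inl ℝ ℝ (Fin n → ℂ)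
/-- The inclusion of `ℂⁿ`, as a continuous linear map. -/
def inZ (n : ℕ) : (Fin n → ℂ) →L[ℝ] Heis n := ContinuousLinearMap.inr ℝ ℝ (Fin n → ℂ)

@[simp] theorem tL_apply (x : Heis n) : tL n x = x.t := rfl
@[simp] theorem zL_apply (x : Heis n) : zL n x = x.z := rfl
theorem inT_apply (s : ℝ) : inT n s = mk s 0 := rfl
theorem inZ_apply (z : Fin n → ℂ) : inZ n z = mk 0 z := rfl
theorem mk_eq (s : ℝ) (z : Fin n → ℂ) : mk s z = inT n s + inZ n z :=
  Heis.ext (show s = s + 0 by simp) (show z = 0 + z by simp)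

@[simp] theorem t_add (x y : Heis n) : (x + y).t = x.t + y.t := rfl
@[simp] theorem z_add (x y : Heis n) : (x + y).z = x.z + y.z := rfl
@[simp] theorem t_sub (x y : Heis n) : (x - y).t = x.t - y.t := rfl
@[simp] theorem z_sub (x y : Heis n) : (x - y).z = x.z - y.z := rfl
@[simp] theorem t_neg (x : Heis n) : (-x).t = -x.t := rfl
@[simp] theorem z_neg (x : Heis n) : (-x).z = -x.z := rfl
@[simp] theorem t_smul (c : ℝ) (x : Heis n) : (c • x).t = c * x.t := rfl
@[simp] theorem z_smul (c : ℝ) (x : Heis n) : (c • x).z = c • x.z := rfl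
@[simp] theorem t_zero : (0 : Heis n).t = 0 := rfl
@[simp] theorem z_zero : (0 : Heis n).z = 0 := rfl

theorem contDiff_mk {F : Type*} [NormedAddCommGroup F] [NormedSpace ℝ F] {f : F → ℝ}
    {g : F → Fin n → ℂ} (hf : ContDiff ℝ ∞ f) (hg : ContDiff ℝ ∞ g) :
    ContDiff ℝ ∞ fun x => mk (f x) (g x) := by
  simp only [mk_eq]
  exact ((inT n).contDiff.comp hf).add ((inZ n).contDiff.comp hg)

/-! ### The contact form and the complex structure in coordinates -/

theorem formCLM_apply (x v : Heis n) : formCLM x v = v.t + imForm x.z v.z := rfl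
theorem t_complexCLM (x v : Heis n) : (complexCLM x v).t = -reForm x.z v.z := by
  rw [← imForm_I_smul_right]; rfl
theorem z_complexCLM (x v : Heis n) : (complexCLM x v).z = Complex.I • v.z := rfl

/-- A tangent vector is determined by its vertical part and its complex coordinates. -/
theorem ext_form {x v w : Heis n} (hf : formCLM x v = formCLM x w) (hz : v.z = w.z) : v = w := by
  refine Heis.ext ?_ hz
  rw [formCLM_apply, formCLM_apply, hz] at hf
  linarith

theorem eq_zero_of_form {x v : Heis n} (hf : formCLM x v = 0) (hz : v.z = 0) : v = 0 :=
  ext_form (x := x) (by rw [hf, map_zero]) hz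

theorem formCLM_complexCLM (x v : Heis n) : formCLM x (complexCLM x v) = 0 := by
  rw [formCLM_apply, t_complexCLM, z_complexCLM, imForm_I_smul_right]; ring

theorem complexCLM_complexCLM {x v : Heis n} (hv : formCLM x v = 0) :
    complexCLM x (complexCLM x v) = -v := by
  refine ext_form (x := x) ?_ ?_
  · rw [formCLM_complexCLM, map_neg, hv, neg_zero]
  · rw [z_complexCLM, z_complexCLM, smul_smul, Complex.I_mul_I, z_neg, neg_one_smul]

/-- The derivative of `formCLM`. -/
def formDeriv (n : ℕ) : Heis n →L[ℝ] Heis n →L[ℝ] ℝ :=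
  ((ContinuousLinearMap.compL ℝ (Heis n) (Fin n → ℂ) ℝ).flip (zL n)).comp ((imFormL n).comp (zL n))

@[simp] theorem formDeriv_apply (v w : Heis n) : formDeriv n v w = imForm v.z w.z := rfl

theorem contDiff_formCLM : ContDiff ℝ ∞ (formCLM : Heis n → Heis n →L[ℝ] ℝ) := by
  have : (formCLM : Heis n → Heis n →L[ℝ] ℝ) = fun x => tL n + formDeriv n x := rfl
  rw [this]
  exact contDiff_const.add (formDeriv n).contDiff

/-- The coefficients of $\omega_0$ are affine in the base point, so the derivative is constant;
antisymmetrising it yields $d\omega_0=2\operatorname{Im}({}^t\bar v w)$. -/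
theorem hasFDerivAt_formCLM (x : Heis n) : HasFDerivAt formCLM (formDeriv n) x := by
  have : (formCLM : Heis n → Heis n →L[ℝ] ℝ) = fun x => tL n + formDeriv n x := rfl
  rw [this]
  exact (formDeriv n).hasFDerivAt.const_add _

theorem complexCLM_eq (x : Heis n) : complexCLM x =
    (inZ n).comp ((mulI n).comp (zL n)) - (inT n).comp ((reFormL n (zL n x)).comp (zL n)) := by
  refine DFunLike.ext _ _ fun v => Heis.ext ?_ ?_
  · rw [t_complexCLM]
    simp [inZ_apply, inT_apply]
  · rw [z_complexCLM]
    simp [inZ_apply, inT_apply]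

theorem contDiff_complexCLM : ContDiff ℝ ∞ (complexCLM : Heis n → Heis n →L[ℝ] Heis n) := by
  have : (complexCLM : Heis n → Heis n →L[ℝ] Heis n) = fun x =>
    (inZ n).comp ((mulI n).comp (zL n)) - (inT n).comp ((reFormL n (zL n x)).comp (zL n)) :=
    funext complexCLM_eq
  rw [this]
  exact contDiff_const.sub (contDiff_const.clm_comp
    (((reFormL n).contDiff.comp (zL n).contDiff).clm_comp contDiff_const))

theorem extDerivOneForm_form (x v w : Heis n) :
    extDerivOneForm (M := Heis n) form x v w = 2 * imForm v.z w.z := by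
  refine (extDerivOneForm_model (η := formCLM) (hasFDerivAt_formCLM x).differentiableAt v w).trans ?_
  rw [(hasFDerivAt_formCLM x).fderiv, formDeriv_apply, formDeriv_apply, imForm_swap v.z w.z]
  ring

theorem extDerivOneForm_form_complex (x v w : Heis n) :
    extDerivOneForm (M := Heis n) form x v (complexCLM x w) = 2 * reForm v.z w.z := by
  rw [extDerivOneForm_form, z_complexCLM, imForm_I_smul_right]

theorem isPseudoHermitian (n : ℕ) : IsPseudoHermitian (M := Heis n) form complexStr reeb where
  smooth_form := contMDiff_oneForm contDiff_formCLM
  smooth_complex := contMDiff_endomorphism contDiff_complexCLM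
  smooth_reeb := contMDiff_vectorSpace_iff_contDiff.2 contDiff_const
  contact :=
    { ne_zero := fun x h => by
        have h1 : formCLM x (mk 1 0) = 0 := DFunLike.congr_fun h (mk (n := n) 1 0)
        rw [formCLM_apply] at h1
        simp [imForm] at h1
      nondegenerate := fun x (v : Heis n) (hv : formCLM x v = 0) h => by
        have h1 := h (complexCLM x v) (formCLM_complexCLM x v)
        rw [extDerivOneForm_form_complex] at h1
        have hz : v.z = 0 := by
          by_contra hz
          have := reForm_self_pos hz
          linarith
        exact eq_zero_of_form hv hz }
  form_reeb := fun x => by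
    change formCLM x (mk 1 0) = 1
    simp [formCLM_apply, imForm]
  extDeriv_reeb := fun x (v : Heis n) => by
    refine (extDerivOneForm_form x (mk 1 0) v).trans ?_
    simp [imForm]
  complex_reeb := fun x => by
    change complexCLM x (mk 1 0) = 0
    refine Heis.ext ?_ ?_
    · rw [t_complexCLM]; simp [reForm]
    · rw [z_complexCLM]; simp
  form_complex := fun x v _ => formCLM_complexCLM x v
  complex_complex := fun x v hv => complexCLM_complexCLM hv
  levi_symm := fun x (v : Heis n) (w : Heis n) _ _ => by
    refine (extDerivOneForm_form_complex x v w).trans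
      (Eq.trans ?_ (extDerivOneForm_form_complex x w v).symm)
    rw [reForm_swap]
  levi_pos := fun x (v : Heis n) (hv : formCLM x v = 0) hv0 => by
    refine lt_of_lt_of_eq ?_ (extDerivOneForm_form_complex x v v).symm
    have hz : v.z ≠ 0 := fun hz => hv0 (eq_zero_of_form hv hz)
    have := reForm_self_pos hz
    linarith

/-- The Reeb flow is translation along the $t$-axis. It leaves $z$ fixed, and the coefficients of
both $\omega_0$ and $J$ depend on $z$ alone. -/
theorem isStandardPseudoHermitian (n : ℕ) :
    IsStandardPseudoHermitian (M := Heis n) form complexStr reeb where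
  toIsPseudoHermitian := isPseudoHermitian n
  flow := by
    have hd : ∀ (s : ℝ) (x v : Heis n),
        modelDeriv (fun y : Heis n => y + inT n s) x v = v := fun s x v => by
      rw [modelDeriv_eq_fderiv, fderiv_add_const, fderiv_fun_id]; rfl
    have hz : ∀ (s : ℝ) (x : Heis n), (x + inT n s).z = x.z := fun s x => by simp [inT_apply]
    refine ⟨fun s x => x + inT n s, ?_, ?_, ?_, ?_, ?_⟩
    · have h : ContDiff ℝ ∞ (fun p : ℝ × Heis n => p.2 + inT n p.1) :=
        contDiff_snd.add ((inT n).contDiff.comp contDiff_fst)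
      rw [← modelWithCornersSelf_prod, chartedSpaceSelf_prod]
      exact h.contMDiff
    · funext x; simp
    · intro s t; funext x; simp [add_assoc, add_comm (inT n s)]
    · intro x s
      have h : HasDerivAt (fun t : ℝ => x + inT n t) (inT n 1) s := by
        simpa using ((inT n).hasFDerivAt.comp_hasDerivAt s (hasDerivAt_id s)).const_add x
      exact h.hasFDerivAt.hasMFDerivAt
    · intro s
      refine ⟨fun x (v : Heis n) => ?_, fun x (v : Heis n) _ => ?_⟩
      · change formCLM (x + inT n s) (modelDeriv (fun y : Heis n => y + inT n s) x v) = formCLM x v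
        rw [hd, formCLM_apply, hz]; rfl
      · change modelDeriv (fun y : Heis n => y + inT n s) x (complexCLM x v) =
          complexCLM (x + inT n s) (modelDeriv (fun y : Heis n => y + inT n s) x v)
        rw [hd, hd, complexCLM_eq, complexCLM_eq, zL_apply, zL_apply, hz]

/-! ### Integrability of the CR structure -/

theorem mlieBracket_eq (X Y : (x : Heis n) → TangentSpace 𝓘(ℝ, Heis n) x) (x : Heis n) :
    VectorField.mlieBracket 𝓘(ℝ, Heis n) X Y x =
      (fderiv ℝ (Y : Heis n → Heis n) x (X x) - fderiv ℝ (X : Heis n → Heis n) x (Y x) : Heis n) := by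
  rw [← VectorField.mlieBracketWithin_univ, VectorField.mlieBracketWithin_eq_lieBracketWithin]
  exact congrFun (VectorField.lieBracketWithin_univ (𝕜 := ℝ) (V := (X : Heis n → Heis n))
    (W := (Y : Heis n → Heis n))) x

theorem z_fderiv {X : Heis n → Heis n} {x : Heis n} (hX : DifferentiableAt ℝ X x) (v : Heis n) :
    (fderiv ℝ X x v).z = fderiv ℝ (fun y => (X y).z) x v := by
  have := ((zL n).hasFDerivAt.comp x hX.hasFDerivAt).fderiv
  exact (DFunLike.congr_fun this v).symm

/-- The vertical part of the derivative of a horizontal vector field. -/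
theorem formCLM_fderiv {X : Heis n → Heis n} {x : Heis n} (hX : DifferentiableAt ℝ X x)
    (h : ∀ y, formCLM y (X y) = 0) (v : Heis n) :
    formCLM x (fderiv ℝ X x v) = -imForm v.z (X x).z := by
  have h1 := ((hasFDerivAt_formCLM x).clm_apply hX.hasFDerivAt).unique
    ((hasFDerivAt_const (0 : ℝ) x).congr_of_eventuallyEq (Filter.Eventually.of_forall h))
  have h2 := DFunLike.congr_fun h1 v
  have h3 : formCLM x (fderiv ℝ X x v) + imForm v.z (X x).z = 0 := by simpa using h2
  linarith

/-- Vertical and complex components are compared separately. The vertical part of the left-hand side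
vanishes since $\operatorname{Im}({}^t\bar a b)$ is invariant under $(a,b)\mapsto(ia,ib)$, and the
right-hand side is horizontal. In the complex components $J$ is the constant operator $i$, which
commutes with differentiation. -/
theorem isCRIntegrable (n : ℕ) : IsCRIntegrable (M := Heis n) form complexStr := by
  intro X Y hX hY hX0 hY0 x
  let X' : Heis n → Heis n := X
  let Y' : Heis n → Heis n := Y
  let JX : Heis n → Heis n := fun p => complexCLM p (X' p)
  let JY : Heis n → Heis n := fun p => complexCLM p (Y' p)
  have dX : Differentiable ℝ X' := (contMDiff_vectorSpace_iff_contDiff.1 hX).differentiable (by simp)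
  have dY : Differentiable ℝ Y' := (contMDiff_vectorSpace_iff_contDiff.1 hY).differentiable (by simp)
  have dJX : Differentiable ℝ JX := (contDiff_complexCLM.differentiable (by simp)).clm_apply dX
  have dJY : Differentiable ℝ JY := (contDiff_complexCLM.differentiable (by simp)).clm_apply dY
  have zJX : ∀ v, (fderiv ℝ JX x v).z = Complex.I • (fderiv ℝ X' x v).z := fun v => by
    rw [z_fderiv (dJX x), z_fderiv (dX x)]
    have := ((mulI n).hasFDerivAt.comp x ((zL n).hasFDerivAt.comp x (dX x).hasFDerivAt)).fderiv
    refine (DFunLike.congr_fun this v).trans ?_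
    rw [← z_fderiv (dX x)]; rfl
  have zJY : ∀ v, (fderiv ℝ JY x v).z = Complex.I • (fderiv ℝ Y' x v).z := fun v => by
    rw [z_fderiv (dJY x), z_fderiv (dY x)]
    have := ((mulI n).hasFDerivAt.comp x ((zL n).hasFDerivAt.comp x (dY x).hasFDerivAt)).fderiv
    refine (DFunLike.congr_fun this v).trans ?_
    rw [← z_fderiv (dY x)]; rfl
  have fX := formCLM_fderiv (dX x) hX0
  have fY := formCLM_fderiv (dY x) hY0
  have fJX := formCLM_fderiv (dJX x) fun y => formCLM_complexCLM y (X' y)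
  have fJY := formCLM_fderiv (dJY x) fun y => formCLM_complexCLM y (Y' y)
  have zJ : ∀ v : Heis n, (complexCLM x v).z = Complex.I • v.z := fun v => rfl
  have key : (fderiv ℝ JY x (JX x) - fderiv ℝ JX x (JY x))
      - (fderiv ℝ Y' x (X' x) - fderiv ℝ X' x (Y' x)) =
      complexCLM x ((fderiv ℝ Y' x (JX x) - fderiv ℝ JX x (Y' x)) +
        (fderiv ℝ JY x (X' x) - fderiv ℝ X' x (JY x))) := by
    refine ext_form (x := x) ?_ ?_
    · rw [formCLM_complexCLM, map_sub, map_sub, map_sub, fX, fY, fJX, fJY]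
      have h1 : (JX x).z = Complex.I • (X' x).z := rfl
      have h2 : (JY x).z = Complex.I • (Y' x).z := rfl
      rw [h1, h2, imForm_I_smul_left, imForm_I_smul_left]
      have h3 : ∀ a b : Fin n → ℂ, reForm a (Complex.I • b) = - imForm a b := fun a b => by
        rw [← imForm_I_smul_right, smul_smul, Complex.I_mul_I, neg_one_smul, imForm_neg_right]
      rw [h3, h3]
      ring
    · rw [zJ]
      simp only [z_sub, z_add, zJX, zJY, smul_add, smul_sub, smul_smul, Complex.I_mul_I,
        neg_one_smul]
      abel
  rw [mlieBracket_eq, mlieBracket_eq, mlieBracket_eq, mlieBracket_eq]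
  exact key

theorem isSasaki (n : ℕ) : IsSasaki (M := Heis n) form complexStr reeb where
  toIsStandardPseudoHermitian := isStandardPseudoHermitian n
  integrable := isCRIntegrable n

/-! ### The Lie group structure, and the group `π` -/

theorem contDiff_imForm {F : Type*} [NormedAddCommGroup F] [NormedSpace ℝ F]
    {f g : F → Fin n → ℂ} (hf : ContDiff ℝ ∞ f) (hg : ContDiff ℝ ∞ g) :
    ContDiff ℝ ∞ fun x => imForm (f x) (g x) :=
  ((imFormL n).contDiff.comp hf).clm_apply hg

theorem contDiff_mul {F : Type*} [NormedAddCommGroup F] [NormedSpace ℝ F]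
    {f g : F → Heis n} (hf : ContDiff ℝ ∞ f) (hg : ContDiff ℝ ∞ g) :
    ContDiff ℝ ∞ fun x => f x * g x := by
  have hft := (tL n).contDiff.comp hf
  have hgt := (tL n).contDiff.comp hg
  have hfz := (zL n).contDiff.comp hf
  have hgz := (zL n).contDiff.comp hg
  exact contDiff_mk ((hft.add hgt).sub (contDiff_imForm hfz hgz)) (hfz.add hgz)

theorem contDiff_inv : ContDiff ℝ ∞ fun x : Heis n => x⁻¹ :=
  contDiff_mk (tL n).contDiff.neg (zL n).contDiff.neg

theorem lieGroup (n : ℕ) : LieGroup 𝓘(ℝ, Heis n) ∞ (Heis n) where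
  contMDiff_mul := by
    rw [← modelWithCornersSelf_prod, chartedSpaceSelf_prod]
    exact (contDiff_mul contDiff_fst contDiff_snd).contMDiff
  contMDiff_inv := contDiff_inv.contMDiff

theorem simplyConnectedSpace (n : ℕ) : SimplyConnectedSpace (Heis n) := inferInstance

/-- The projection of the Heisenberg group onto `ℂⁿ`. -/
def zHom (n : ℕ) : Heis n →* Multiplicative (Fin n → ℂ) where
  toFun x := Multiplicative.ofAdd x.z
  map_one' := rfl
  map_mul' _ _ := rfl

/-- Two-step nilpotency: the projection to the abelian group $\mathbb C^n$ has central kernel. -/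
theorem isNilpotent (n : ℕ) : Group.IsNilpotent (Heis n) := by
  refine Subgroup.isNilpotent_of_ker_le_center (zHom n) ?_
  intro x hx
  have hz : x.z = 0 := hx
  refine Subgroup.mem_center_iff.2 fun y => Heis.ext ?_ ?_
  · simp [hz, imForm, add_comm]
  · simp [add_comm]

/-! #### The automorphism `τ` -/

/-- Complex conjugation on `ℂⁿ`. -/
def conjL (n : ℕ) : (Fin n → ℂ) →L[ℝ] (Fin n → ℂ) :=
  ContinuousLinearMap.pi fun i =>
    (Complex.conjCLE : ℂ →L[ℝ] ℂ).comp (ContinuousLinearMap.proj i)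

theorem conjL_apply (z : Fin n → ℂ) : conjL n z = fun i => conj (z i) := rfl

/-- `τ` as a continuous linear map. -/
def tauL (n : ℕ) : Heis n →L[ℝ] Heis n :=
  (inZ n).comp ((conjL n).comp (zL n)) - (inT n).comp (tL n)

theorem t_tau (x : Heis n) : (tau n x).t = -x.t := rfl
theorem z_tau (x : Heis n) : (tau n x).z = fun i => conj (x.z i) := rfl

theorem tauL_apply (x : Heis n) : tauL n x = tau n x := by
  refine Heis.ext ?_ ?_
  · rw [t_tau]; simp [tauL, inT_apply, inZ_apply]
  · rw [z_tau, ← conjL_apply]; simp [tauL, inT_apply, inZ_apply]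

theorem coe_tau : (tau n : Heis n → Heis n) = tauL n := funext fun x => (tauL_apply x).symm

theorem modelDeriv_tau (x v : Heis n) : modelDeriv (tau n) x v = tau n v := by
  rw [modelDeriv_eq_fderiv, coe_tau, ContinuousLinearMap.fderiv]

theorem tau_tau (x : Heis n) : tau n (tau n x) = x := (tau n).left_inv x

theorem tau_mul_tau : tau n * tau n = 1 := MulEquiv.ext tau_tau

theorem tau_ne_one : tau n ≠ 1 := fun h => by
  have h1 := congrArg t (DFunLike.congr_fun h (mk 1 0))
  rw [t_tau] at h1
  simp at h1
  norm_num at h1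

theorem orderOf_tau : orderOf (tau n) = 2 :=
  orderOf_eq_prime (by rw [pow_two, tau_mul_tau]) tau_ne_one

theorem formCLM_tau (x v : Heis n) : formCLM (tau n x) (tau n v) = -formCLM x v := by
  rw [formCLM_apply, formCLM_apply, t_tau, z_tau, z_tau, imForm_conj]; ring

theorem reversesPsh_tau (n : ℕ) : ReversesPsh (M := Heis n) form complexStr (tau n) where
  form := fun x (v : Heis n) => by
    change formCLM (tau n x) (modelDeriv (tau n) x v) = -formCLM x v
    rw [modelDeriv_tau, formCLM_tau]
  complex := fun x (v : Heis n) _ => by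
    change modelDeriv (tau n) x (complexCLM x v) =
      -complexCLM (tau n x) (modelDeriv (tau n) x v)
    rw [modelDeriv_tau, modelDeriv_tau]
    refine ext_form (x := tau n x) ?_ ?_
    · rw [map_neg, formCLM_complexCLM, formCLM_tau, formCLM_complexCLM]
    · rw [z_neg, z_complexCLM, z_tau, z_tau, z_complexCLM]
      funext i
      simp

/-! #### The group `π` -/

theorem tau_mem_lattice {x : Heis n} (hx : x ∈ lattice n) : tau n x ∈ lattice n := by
  obtain ⟨⟨a, ha⟩, h⟩ := hx
  refine ⟨⟨-a, by rw [t_tau, ha]; simp⟩, fun i => ?_⟩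
  obtain ⟨⟨b, hb⟩, ⟨c, hc⟩⟩ := h i
  exact ⟨⟨b, by rw [z_tau]; simp [hb]⟩, ⟨-c, by rw [z_tau]; simp [hc]⟩⟩

theorem imForm_alpha [NeZero n] (s : ℝ) (z : Fin n → ℂ) : imForm (alpha n s).z z = s * (z 0).im := by
  rw [imForm_eq_sum, Finset.sum_eq_single 0]
  · simp [alpha]
  · intro i _ hi
    simp [alpha, hi]
  · simp

theorem inv_alpha (s : ℝ) : (alpha n s)⁻¹ = alpha n (-s) := by
  refine Heis.ext (by simp [alpha]) ?_
  funext i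
  simp only [alpha, z_inv, z_mk, Pi.neg_apply]
  split_ifs <;> simp

theorem tau_alpha (s : ℝ) : tau n (alpha n s) = alpha n s := by
  refine Heis.ext (by rw [t_tau]; simp [alpha]) ?_
  rw [z_tau]
  funext i
  simp only [alpha, z_mk]
  split_ifs <;> simp

theorem alpha_mul_alpha (s r : ℝ) : alpha n s * alpha n r = alpha n (s + r) := by
  have hz : (alpha n s).z + (alpha n r).z = (alpha n (s + r)).z := by
    funext i
    simp only [alpha, z_mk, Pi.add_apply]
    split_ifs <;> simp
  refine Heis.ext ?_ hz
  have : imForm (alpha n s).z (alpha n r).z = 0 := by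
    rw [imForm_eq_sum]
    refine Finset.sum_eq_zero fun i _ => ?_
    simp only [alpha, z_mk]
    split_ifs <;> simp
  rw [t_mul, this]
  simp [alpha]

theorem alpha_mem_lattice (m : ℤ) : alpha n m ∈ lattice n := by
  refine ⟨⟨0, by simp [alpha]⟩, fun i => ?_⟩
  simp only [alpha, z_mk]
  split_ifs
  · exact ⟨⟨m, by simp⟩, ⟨0, by simp⟩⟩
  · exact ⟨⟨0, by simp⟩, ⟨0, by simp⟩⟩

theorem t_conj (a x : Heis n) : (a * x * a⁻¹).t = x.t - 2 * imForm a.z x.z := by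
  simp only [t_mul, z_mul, t_inv, z_inv, imForm_neg_right, imForm_add_left, imForm_self,
    imForm_swap a.z x.z]
  ring

theorem z_conj (a x : Heis n) : (a * x * a⁻¹).z = x.z := by simp

/-- Conjugation by $\alpha_s$ fixes $z$ and changes $t$ by $-2s\operatorname{Im}z_0$. The factor $2$
is what admits $s=\tfrac12$. -/
theorem conj_mem_lattice [NeZero n] {s : ℝ} {m : ℤ} (hs : 2 * s = m) {x : Heis n}
    (hx : x ∈ lattice n) : alpha n s * x * (alpha n s)⁻¹ ∈ lattice n := by
  obtain ⟨⟨a, ha⟩, h⟩ := hx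
  refine ⟨?_, by rw [z_conj]; exact h⟩
  obtain ⟨c, hc⟩ := (h 0).2
  refine ⟨a - m * c, ?_⟩
  rw [t_conj, imForm_alpha, ha, hc, ← mul_assoc, hs]
  simp

theorem smul_def (γ : Aff n) (x : Heis n) : γ • x = γ.left * γ.right x := rfl

theorem mem_latticeAff {γ : Aff n} : γ ∈ latticeAff n ↔ γ.right = 1 ∧ γ.left ∈ lattice n := by
  constructor
  · rintro ⟨x, hx, rfl⟩
    exact ⟨rfl, hx⟩
  · rintro ⟨h1, h2⟩
    exact ⟨γ.left, h2, SemidirectProduct.ext rfl h1.symm⟩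

theorem left_mu : (mu n).left = alpha n (1 / 2) := by simp [mu]
theorem right_mu : (mu n).right = tau n := by simp [mu]

/-- The elements of `π` are those of `Λ` and those of `α_{1/2} Λ τ`. -/
theorem piGroup_cases [NeZero n] {γ : Aff n} (hγ : γ ∈ piGroup n) :
    (γ.right = 1 ∧ γ.left ∈ lattice n) ∨
      (γ.right = tau n ∧ ∃ l ∈ lattice n, γ.left = alpha n (1 / 2) * l) := by
  -- Moves $\alpha_{1/2}$ to the left past $\Lambda$, with $l'=\alpha_{1/2}^{-1}l\,\alpha_{1/2}$.
  have hc : ∀ l ∈ lattice n, ∃ l' ∈ lattice n, l * alpha n (1 / 2) = alpha n (1 / 2) * l' :=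
    fun l hl => ⟨_, conj_mem_lattice (s := -(1 / 2)) (m := -1) (by norm_num) hl, by
      rw [← inv_alpha]; group⟩
  -- Since $\tau$ fixes $\alpha_{1/2}$, this element is $\mu^2=\alpha_1$; it keeps products within
  -- the second coset inside $\Lambda$.
  have h2 : alpha n (1 / 2) * alpha n (1 / 2) ∈ lattice n := by
    rw [alpha_mul_alpha, add_halves]
    simpa using alpha_mem_lattice (n := n) 1
  induction hγ using Subgroup.closure_induction with
  | mem γ h =>
    rcases h with h | h
    · rw [Set.mem_singleton_iff] at h
      subst h
      exact Or.inr ⟨right_mu, 1, one_mem _, by rw [left_mu, mul_one]⟩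
    · exact Or.inl (mem_latticeAff.1 h)
  | one => exact Or.inl ⟨rfl, one_mem _⟩
  | mul γ δ _ _ hγ hδ =>
    have hl : (γ * δ).left = γ.left * γ.right δ.left := by simp
    have hr : (γ * δ).right = γ.right * δ.right := by simp
    rw [hl, hr]
    rcases hγ with ⟨h1, h3⟩ | ⟨h1, l, hl, h3⟩ <;> rcases hδ with ⟨h4, h5⟩ | ⟨h4, m, hm, h5⟩ <;>
      rw [h1, h4]
    · exact Or.inl ⟨mul_one _, mul_mem h3 h5⟩
    · obtain ⟨k, hk, hk'⟩ := hc _ h3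
      refine Or.inr ⟨one_mul _, k * m, mul_mem hk hm, ?_⟩
      rw [h5, MulAut.one_apply, ← mul_assoc, hk', mul_assoc]
    · refine Or.inr ⟨mul_one _, l * tau n δ.left, mul_mem hl (tau_mem_lattice h5), ?_⟩
      rw [h3, mul_assoc]
    · obtain ⟨k, hk, hk'⟩ := hc _ hl
      refine Or.inl ⟨tau_mul_tau, ?_⟩
      rw [h3, h5, map_mul, tau_alpha, ← mul_assoc, mul_assoc _ l, hk', ← mul_assoc]
      exact mul_mem (mul_mem h2 hk) (tau_mem_lattice hm)
  | inv γ _ hγ =>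
    have hl : (γ⁻¹).left = γ.right⁻¹ γ.left⁻¹ := by simp
    have hr : (γ⁻¹).right = γ.right⁻¹ := by simp
    rw [hl, hr]
    rcases hγ with ⟨h1, h3⟩ | ⟨h1, l, hl, h3⟩ <;> rw [h1]
    · exact Or.inl ⟨inv_one, by simpa using h3⟩
    · have ht : (tau n)⁻¹ = tau n := inv_eq_of_mul_eq_one_left tau_mul_tau
      obtain ⟨k, hk, hk'⟩ := hc _ (inv_mem (tau_mem_lattice hl))
      -- The inverse has translation part
      -- $\tau(l)^{-1}\alpha_{1/2}^{-1}=\tau(l)^{-1}\alpha_{1/2}\,\alpha_1^{-1}$, and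
      -- $\tau(l)^{-1}\alpha_{1/2}=\alpha_{1/2}k$.
      refine Or.inr ⟨ht, k * (alpha n (1 / 2) * alpha n (1 / 2))⁻¹, mul_mem hk (inv_mem h2), ?_⟩
      rw [ht, h3, map_inv, map_mul, tau_alpha, mul_inv_rev, ← mul_assoc, ← hk', mul_inv_rev]
      group

theorem right_mem_zpowers [NeZero n] {γ : Aff n} (hγ : γ ∈ piGroup n) :
    γ.right ∈ Subgroup.zpowers (tau n) := by
  rcases piGroup_cases hγ with ⟨h, -⟩ | ⟨h, -⟩ <;> rw [h]
  · exact one_mem _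
  · exact Subgroup.mem_zpowers _

theorem latticeAff_le : latticeAff n ≤ piGroup n := fun _ h =>
  Subgroup.subset_closure (Or.inr h)

theorem mu_mem : mu n ∈ piGroup n := Subgroup.subset_closure (Or.inl rfl)

theorem mem_latticeAff_iff_right [NeZero n] {γ : Aff n} (hγ : γ ∈ piGroup n) :
    γ ∈ latticeAff n ↔ γ.right = 1 := by
  rw [mem_latticeAff]
  refine ⟨And.left, fun h => ⟨h, ?_⟩⟩
  rcases piGroup_cases hγ with h1 | ⟨h1, -⟩
  · exact h1.2
  · exact absurd (h1.symm.trans h) tau_ne_one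

theorem relIndex_latticeAff [NeZero n] : (latticeAff n).relIndex (piGroup n) = 2 := by
  rw [Subgroup.relIndex, Subgroup.index_eq_two_iff]
  refine ⟨⟨mu n, mu_mem⟩, fun ⟨γ, hγ⟩ => ?_⟩
  rw [Subgroup.mem_subgroupOf, Subgroup.mem_subgroupOf]
  change Xor (γ * mu n ∈ latticeAff n) (γ ∈ latticeAff n)
  rw [mem_latticeAff_iff_right hγ, mem_latticeAff_iff_right (mul_mem hγ mu_mem),
    SemidirectProduct.mul_right, right_mu]
  rcases piGroup_cases hγ with ⟨h1, -⟩ | ⟨h1, -⟩ <;> rw [h1]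
  · exact Or.inr ⟨rfl, by rw [one_mul]; exact tau_ne_one⟩
  · exact Or.inl ⟨tau_mul_tau, tau_ne_one⟩

/-! ### Torsion-freeness and freeness of the action -/

theorem pow_eq (x : Heis n) (k : ℕ) : x ^ k = mk (k * x.t) ((k : ℝ) • x.z) := by
  induction k with
  | zero => exact Heis.ext (by simp) (by simp)
  | succ k ih =>
    rw [pow_succ, ih]
    refine Heis.ext ?_ ?_
    · simp only [t_mul, t_mk, z_mk, imForm_smul_left, imForm_self]; push_cast; ring
    · simp only [z_mul, z_mk]; push_cast; rw [add_smul, one_smul]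

theorem eq_one_of_pow_eq_one {x : Heis n} {k : ℕ} (hk : k ≠ 0) (h : x ^ k = 1) : x = 1 := by
  rw [pow_eq] at h
  have hk' : (k : ℝ) ≠ 0 := Nat.cast_ne_zero.2 hk
  have h1 := congrArg t h
  have h2 := congrArg z h
  simp only [t_mk, z_mk, t_one, z_one] at h1 h2
  exact Heis.ext ((mul_eq_zero.1 h1).resolve_left hk') ((smul_eq_zero.1 h2).resolve_left hk')

/-- This real part lies in $\tfrac12+\mathbb Z$. As $\tau$ preserves real parts, every element of
the second coset shifts $\operatorname{Re}z_0$ by such a number. -/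
theorem re_alpha_mul_ne_zero [NeZero n] {l : Heis n} (hl : l ∈ lattice n) :
    ((alpha n (1 / 2) * l).z 0).re ≠ 0 := by
  obtain ⟨b, hb⟩ := (hl.2 0).1
  simp only [z_mul, Pi.add_apply, Complex.add_re, hb]
  intro h
  have h1 : (1 : ℝ) + 2 * b = 0 := by
    simp [alpha] at h
    linarith
  have h2 : (1 : ℤ) + 2 * b = 0 := by exact_mod_cast h1
  omega

theorem left_pow_of_right_eq_one {γ : Aff n} (h : γ.right = 1) (k : ℕ) :
    (γ ^ k).left = γ.left ^ k := by
  have : γ = SemidirectProduct.inl γ.left := SemidirectProduct.ext rfl h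
  rw [this, ← map_pow]
  rfl

theorem eq_one_of_isOfFinOrder [NeZero n] {γ : Aff n} (hγ : γ ∈ piGroup n)
    (hf : IsOfFinOrder γ) : γ = 1 := by
  have key : ∀ δ : Aff n, δ.right = 1 → IsOfFinOrder δ → δ = 1 := fun δ h hδ => by
    obtain ⟨k, hk, hk'⟩ := isOfFinOrder_iff_pow_eq_one.1 hδ
    have h1 := left_pow_of_right_eq_one h k
    rw [hk'] at h1
    exact SemidirectProduct.ext (eq_one_of_pow_eq_one hk.ne' h1.symm) h
  rcases piGroup_cases hγ with ⟨h1, -⟩ | ⟨h1, l, hl, h2⟩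
  · exact key γ h1 hf
  · have h3 : (γ * γ).right = 1 := by rw [SemidirectProduct.mul_right, h1, tau_mul_tau]
    have h4 := key _ h3 (by simpa [pow_two] using hf.pow (n := 2))
    have h5 : (γ.left * tau n γ.left).z 0 = 0 := by
      have := congrArg (fun δ : Aff n => δ.left.z 0) h4
      simpa [h1] using this
    have h6 := congrArg Complex.re h5
    rw [z_mul, z_tau] at h6
    simp only [Pi.add_apply, Complex.add_re, Complex.conj_re, Complex.zero_re] at h6
    exact absurd (by rw [← h2]; linarith) (re_alpha_mul_ne_zero hl)

theorem eq_one_of_smul_eq [NeZero n] {γ : Aff n} (hγ : γ ∈ piGroup n) {x : Heis n}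
    (h : γ • x = x) : γ = 1 := by
  rw [smul_def] at h
  rcases piGroup_cases hγ with ⟨h1, -⟩ | ⟨h1, l, hl, h2⟩
  · rw [h1, MulAut.one_apply] at h
    exact SemidirectProduct.ext (mul_eq_right.1 h) h1
  · have h6 := congrArg (fun y : Heis n => (y.z 0).re) h
    rw [h1] at h6
    simp only [z_mul, z_tau, Pi.add_apply, Complex.add_re, Complex.conj_re] at h6
    exact absurd (by rw [← h2]; linarith) (re_alpha_mul_ne_zero hl)

local instance isCancelSMul [NeZero n] : IsCancelSMul (piGroup n) (Heis n) where
  right_cancel' := fun g g' x h => by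
    have h1 : (g'⁻¹ * g) • x = x := by rw [mul_smul, h, inv_smul_smul]
    have h2 := eq_one_of_smul_eq (g'⁻¹ * g).2 h1
    exact (inv_mul_eq_one.1 (Subtype.ext h2)).symm

theorem isSmoothAction [NeZero n] : SmoothQuotient.IsSmoothAction (Heis n) (piGroup n) := by
  intro g
  change ContDiff ℝ ∞ fun x : Heis n => (g : Aff n).left * (g : Aff n).right x
  refine contDiff_mul contDiff_const ?_
  rcases piGroup_cases g.2 with ⟨h1, -⟩ | ⟨h1, -⟩ <;> rw [h1]
  · exact contDiff_id
  · rw [coe_tau]; exact (tauL n).contDiff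

local instance continuousConstSMul [NeZero n] : ContinuousConstSMul (piGroup n) (Heis n) :=
  ⟨fun g => (isSmoothAction g).continuous⟩

/-! ### Proper discontinuity and compactness of the quotient -/

theorem abs_t_le (x : Heis n) : |x.t| ≤ ‖x‖ := norm_fst_le (E := ℝ) (F := Fin n → ℂ) x
theorem norm_z_le (x : Heis n) (i : Fin n) : ‖x.z i‖ ≤ ‖x‖ :=
  (norm_le_pi_norm x.z i).trans (norm_snd_le (E := ℝ) (F := Fin n → ℂ) x)
theorem norm_le {x : Heis n} {r : ℝ} (hr : 0 ≤ r) (ht : |x.t| ≤ r) (hz : ∀ i, ‖x.z i‖ ≤ r) :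
    ‖x‖ ≤ r := max_le ht ((pi_norm_le_iff_of_nonneg hr).2 hz)

theorem finite_lattice_inter {C : Set (Heis n)} (hC : IsCompact C) :
    ((lattice n : Set (Heis n)) ∩ C).Finite := by
  obtain ⟨R, hR⟩ := hC.isBounded.exists_norm_le
  obtain ⟨N, hN⟩ := exists_nat_ge R
  let S : Set (ℤ × (Fin n → ℤ × ℤ)) :=
    Set.Icc (-N : ℤ) N ×ˢ Set.univ.pi fun _ => Set.Icc (-N : ℤ) N ×ˢ Set.Icc (-N : ℤ) N
  have hS : S.Finite := (Set.finite_Icc _ _).prod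
    (Set.Finite.pi' fun _ => (Set.finite_Icc _ _).prod (Set.finite_Icc _ _)) |>.subset (by
      rintro ⟨a, b⟩ ⟨h1, h2⟩
      exact ⟨h1, fun i => h2 i trivial⟩)
  refine (hS.image fun p : ℤ × (Fin n → ℤ × ℤ) =>
    (mk p.1 fun i => ⟨(p.2 i).1, (p.2 i).2⟩ : Heis n)).subset ?_
  rintro x ⟨⟨⟨a, ha⟩, h⟩, hx⟩
  choose b hb using fun i => (h i).1
  choose c hc using fun i => (h i).2
  have hbd : ∀ (m : ℤ) (r : ℝ), r = m → |r| ≤ R → m ∈ Set.Icc (-N : ℤ) N := fun m r hm hr => by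
    rw [hm] at hr
    have h1 := abs_le.1 (hr.trans hN)
    exact ⟨by exact_mod_cast h1.1, by exact_mod_cast h1.2⟩
  refine ⟨(a, fun i => (b i, c i)), ⟨hbd a _ ha ((abs_t_le x).trans (hR x hx)), fun i _ =>
    ⟨hbd _ _ (hb i) ?_, hbd _ _ (hc i) ?_⟩⟩, ?_⟩
  · exact ((Complex.abs_re_le_norm _).trans (norm_z_le x i)).trans (hR x hx)
  · exact ((Complex.abs_im_le_norm _).trans (norm_z_le x i)).trans (hR x hx)
  · refine Heis.ext ha.symm (funext fun i => Complex.ext (hb i).symm (hc i).symm)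

theorem isTopologicalGroup (n : ℕ) : IsTopologicalGroup (Heis n) :=
  have := lieGroup n
  topologicalGroup_of_lieGroup 𝓘(ℝ, Heis n) ∞

theorem continuous_tau : Continuous (tau n) := by
  rw [coe_tau]; exact (tauL n).continuous

open Pointwise in
local instance properlyDiscontinuousSMul [NeZero n] :
    ProperlyDiscontinuousSMul (piGroup n) (Heis n) where
  finite_disjoint_inter_image := by
    intro K L hK hL
    have := isTopologicalGroup n
    -- If $\gamma x=y$ with $x\in K$, $y\in L$, then either $\gamma$ is translation by $l=yx^{-1}$,
    -- or $\gamma=\alpha_{1/2}l\,\tau$ with $l=\alpha_{1/2}^{-1}y\,\tau(x)^{-1}$. In both cases $l$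
    -- lies in a fixed compact set.
    have h1 := finite_lattice_inter (hL.mul hK.inv)
    have h2 := finite_lattice_inter
      ((isCompact_singleton (x := (alpha n (1 / 2))⁻¹)).mul (hL.mul (hK.image continuous_tau).inv))
    have h3 : (((fun x => (⟨x, 1⟩ : Aff n)) '' ((lattice n : Set (Heis n)) ∩ (L * K⁻¹))) ∪
      ((fun x => (⟨alpha n (1 / 2) * x, tau n⟩ : Aff n)) '' ((lattice n : Set (Heis n)) ∩
        ({(alpha n (1 / 2))⁻¹} * (L * (tau n '' K)⁻¹))))).Finite :=
      (h1.image _).union (h2.image _)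
    refine (h3.preimage (Subtype.val_injective.injOn)).subset ?_
    rintro ⟨γ, hγ⟩ hne
    obtain ⟨y, ⟨x, hx, hxy⟩, hy⟩ := hne
    have hxy' : γ.left * γ.right x = y := hxy
    rcases piGroup_cases hγ with ⟨h5, h6⟩ | ⟨h5, l, hl, h6⟩
    · left
      rw [h5, MulAut.one_apply] at hxy'
      refine ⟨γ.left, ⟨h6, Set.mem_mul.2 ⟨y, hy, x⁻¹, Set.inv_mem_inv.2 hx, ?_⟩⟩,
        SemidirectProduct.ext rfl h5.symm⟩
      rw [← hxy', mul_inv_cancel_right]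
    · right
      rw [h5, h6] at hxy'
      refine ⟨l, ⟨hl, Set.mem_mul.2 ⟨_, rfl, y * (tau n x)⁻¹, Set.mul_mem_mul hy
        (Set.inv_mem_inv.2 ⟨x, hx, rfl⟩), ?_⟩⟩, SemidirectProduct.ext h6.symm h5.symm⟩
      rw [← hxy', mul_inv_cancel_right, inv_mul_cancel_left]

theorem compactSpace_infraNil (n : ℕ) : CompactSpace (InfraNil n) := by
  have hK : IsCompact (Metric.closedBall (0 : Heis n) 2) :=
    have : ProperSpace (Heis n) := FiniteDimensional.proper_real _
    isCompact_closedBall _ _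
  refine ⟨?_⟩
  have hc : Continuous (proj n) := continuous_quotient_mk'
  convert hK.image hc
  refine (Set.eq_univ_of_forall fun p => ?_).symm
  induction p using Quotient.inductionOn with | _ x => ?_
  -- First reduce $z$ modulo the Gaussian integers. Translation by `w` also shifts $t$ by
  -- $-\operatorname{Im}({}^t\bar w z)$, so the central coordinate is rounded only after that shift.
  -- The radius $2$ bounds $|\operatorname{Re}|+|\operatorname{Im}|$ in each coordinate.
  let w : Fin n → ℂ := fun i => ⟨-⌊(x.z i).re⌋, -⌊(x.z i).im⌋⟩
  let s : ℝ := -⌊x.t - imForm w x.z⌋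
  let l : Heis n := mk s w
  have hl : l ∈ lattice n := ⟨⟨-⌊x.t - imForm w x.z⌋, by simp [l, s]⟩, fun i =>
    ⟨⟨-⌊(x.z i).re⌋, by simp [l, w]⟩, ⟨-⌊(x.z i).im⌋, by simp [l, w]⟩⟩⟩
  let γ : piGroup n := ⟨SemidirectProduct.inl l, latticeAff_le ⟨l, hl, rfl⟩⟩
  have hf : ∀ r : ℝ, |-(⌊r⌋ : ℝ) + r| ≤ 1 := fun r => by
    rw [neg_add_eq_sub, abs_le]
    constructor <;> linarith [Int.floor_le r, Int.lt_floor_add_one r]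
  refine ⟨l * x, ?_, Quotient.sound ⟨γ, rfl⟩⟩
  rw [mem_closedBall_zero_iff]
  refine norm_le (by norm_num) ?_ fun i => ?_
  · have : (l * x).t = -(⌊x.t - imForm w x.z⌋ : ℝ) + (x.t - imForm w x.z) := by
      simp [l, s]; ring
    rw [this]
    linarith [hf (x.t - imForm w x.z)]
  · refine (Complex.norm_le_abs_re_add_abs_im _).trans ?_
    have h1 := hf (x.z i).re
    have h2 := hf (x.z i).im
    simp only [z_mul, Pi.add_apply, Complex.add_re, Complex.add_im, l, z_mk, w]
    linarith

theorem t2Space_infraNil [NeZero n] : T2Space (InfraNil n) :=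
  t2Space_of_properlyDiscontinuousSMul_of_t2Space

/-! ### The Sasaki metric and its Killing fields -/

/-- The form `2 Re (ᵗv̄ w)` as a bilinear form on tangent vectors. -/
def leviCLM (n : ℕ) : Heis n →L[ℝ] Heis n →L[ℝ] ℝ :=
  (2 : ℝ) • ((ContinuousLinearMap.compL ℝ (Heis n) (Fin n → ℂ) ℝ).flip (zL n)).comp
    ((reFormL n).comp (zL n))

theorem leviCLM_apply (v w : Heis n) : leviCLM n v w = 2 * reForm v.z w.z :=
  congrArg (2 * ·) (reFormL_apply v.z w.z)

/-- The Sasaki metric `ω₀ · ω₀ + dω₀ ∘ J`. -/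
def metricCLM (x : Heis n) : Heis n →L[ℝ] Heis n →L[ℝ] ℝ :=
  (formCLM x).smulRight (formCLM x) + leviCLM n

theorem metricCLM_apply (x v w : Heis n) :
    metricCLM x v w = formCLM x v * formCLM x w + 2 * reForm v.z w.z := by
  rw [← leviCLM_apply]; rfl

theorem contDiff_metricCLM : ContDiff ℝ ∞ (metricCLM : Heis n → Heis n →L[ℝ] Heis n →L[ℝ] ℝ) :=
  (contDiff_formCLM.smulRight contDiff_formCLM).add contDiff_const

theorem fderiv_metricCLM (x u v w : Heis n) : fderiv ℝ metricCLM x u v w =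
    imForm u.z v.z * formCLM x w + formCLM x v * imForm u.z w.z := by
  have hd : DifferentiableAt ℝ (metricCLM : Heis n → _) x :=
    contDiff_metricCLM.differentiable (by simp) x
  have h1 : HasFDerivAt (fun y => metricCLM y v w) _ x :=
    (hd.hasFDerivAt.clm_apply (hasFDerivAt_const v x)).clm_apply (hasFDerivAt_const w x)
  have hv := (hasFDerivAt_formCLM x).clm_apply (hasFDerivAt_const v x)
  have hw := (hasFDerivAt_formCLM x).clm_apply (hasFDerivAt_const w x)
  have h2 := ((hv.mul hw).add_const (2 * reForm v.z w.z)).congr_of_eventuallyEq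
    (f₁ := fun y => metricCLM y v w) (Filter.Eventually.of_forall fun y => metricCLM_apply y v w)
  have h3 := DFunLike.congr_fun (h1.unique h2) u
  have h4 : fderiv ℝ metricCLM x u v w = formCLM x v * imForm u.z w.z +
    formCLM x w * imForm u.z v.z := by simpa using h3
  rw [h4]; ring

theorem metricCLM_symm (x v w : Heis n) : metricCLM x v w = metricCLM x w v := by
  rw [metricCLM_apply, metricCLM_apply, reForm_swap]; ring

theorem reForm_self_nonneg (z : Fin n → ℂ) : 0 ≤ reForm z z := by
  rw [reForm_eq_sum]
  exact Finset.sum_nonneg fun i _ => add_nonneg (mul_self_nonneg _) (mul_self_nonneg _)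

theorem metricCLM_pos (x : Heis n) {v : Heis n} (hv : v ≠ 0) : 0 < metricCLM x v v := by
  rw [metricCLM_apply]
  by_cases hz : v.z = 0
  · have : formCLM x v ≠ 0 := fun h => hv (eq_zero_of_form h hz)
    have h1 := mul_self_pos.2 this
    linarith [reForm_self_nonneg v.z]
  · linarith [reForm_self_pos hz, mul_self_nonneg (formCLM x v)]

theorem isVonNBounded_metricCLM (x : Heis n) :
    Bornology.IsVonNBounded ℝ {v : Heis n | metricCLM x v v < 1} := by
  rw [NormedSpace.isVonNBounded_iff, isBounded_iff_forall_norm_le]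
  -- On the unit ball of the metric $|\omega_0(v)|\le1$ and $|v_i|\le1$, and
  -- $t(v)=\omega_0(v)-\operatorname{Im}({}^t\bar z v_z)$.
  refine ⟨1 + ‖imFormL n x.z‖, fun v hv => ?_⟩
  have hv' : formCLM x v * formCLM x v + 2 * reForm v.z v.z < 1 := by
    rw [← metricCLM_apply]; exact hv
  have hC := norm_nonneg (imFormL n x.z)
  have hz : ∀ i, ‖v.z i‖ ≤ 1 := fun i => by
    have h1 : Complex.normSq (v.z i) ≤ reForm v.z v.z := by
      rw [reForm_eq_sum, Complex.normSq_apply]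
      exact Finset.single_le_sum (f := fun i => (v.z i).re * (v.z i).re + (v.z i).im * (v.z i).im)
        (fun j _ => add_nonneg (mul_self_nonneg _) (mul_self_nonneg _)) (Finset.mem_univ i)
    rw [Complex.normSq_eq_norm_sq] at h1
    nlinarith [mul_self_nonneg (formCLM x v), norm_nonneg (v.z i)]
  have hf : |formCLM x v| ≤ 1 := by
    rw [← sq_le_one_iff_abs_le_one]
    nlinarith [reForm_self_nonneg v.z]
  refine norm_le (by linarith) ?_ fun i => (hz i).trans (by linarith)
  have h2 : |imForm x.z v.z| ≤ ‖imFormL n x.z‖ := by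
    have := (imFormL n x.z).le_opNorm v.z
    have h3 : ‖v.z‖ ≤ 1 := (pi_norm_le_iff_of_nonneg zero_le_one).2 hz
    rw [imFormL_apply, Real.norm_eq_abs] at this
    nlinarith
  rw [formCLM_apply] at hf
  rw [abs_le] at hf h2 ⊢
  constructor <;> linarith

/-- The Sasaki metric of the Heisenberg group. -/
def metric (n : ℕ) : RiemMetric (Heis n) (Heis n) where
  inner x := metricCLM x
  symm x v w := metricCLM_symm x v w
  pos x v hv := metricCLM_pos x hv
  isVonNBounded x := isVonNBounded_metricCLM x
  contMDiff p := contMDiffAt_bilinear contDiff_metricCLM p fun y _ v w => by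
    have h3 : ∀ u : Heis n, modelDeriv (id : Heis n → Heis n) y u = u := fun u => by
      rw [modelDeriv_eq_fderiv, fderiv_id]; rfl
    change metricCLM y (modelDeriv (id : Heis n → Heis n) y v)
      (modelDeriv (id : Heis n → Heis n) y w) = metricCLM y v w
    rw [h3, h3]

theorem isCompatible_metric (n : ℕ) : IsCompatible (metric n) form complexStr := fun x v w =>
  (metricCLM_apply x v w).trans
    (congrArg (_ + ·) (extDerivOneForm_form_complex x v w).symm)

/-! #### Invariance -/

/-- The derivative of left translation by `a`. -/
def leftL (a : Heis n) : Heis n →L[ℝ] Heis n :=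
  ContinuousLinearMap.id ℝ (Heis n) - (inT n).comp ((imFormL n a.z).comp (zL n))

theorem z_leftL (a v : Heis n) : (leftL a v).z = v.z := by simp [leftL, inT_apply]

theorem t_leftL (a v : Heis n) : (leftL a v).t = v.t - imForm a.z v.z := by
  simp [leftL, inT_apply]

theorem mul_eq_add_leftL (a x : Heis n) : a * x = a + leftL a x := by
  refine Heis.ext ?_ ?_
  · rw [t_mul, t_add, t_leftL]; ring
  · rw [z_mul, z_add, z_leftL]

theorem hasFDerivAt_mul_left (a x : Heis n) : HasFDerivAt (fun y => a * y) (leftL a) x := by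
  simp only [mul_eq_add_leftL]
  exact (leftL a).hasFDerivAt.const_add a

/-- Left invariance of $\omega_0$: the term $-\operatorname{Im}({}^t\bar a v_z)$ from the
differential of the translation cancels the change of base point from $z$ to $a_z+z$. -/
theorem formCLM_leftL (a x v : Heis n) : formCLM (a * x) (leftL a v) = formCLM x v := by
  rw [formCLM_apply, formCLM_apply, t_leftL, z_leftL, z_mul, imForm_add_left]; ring

theorem fderiv_smul_of_right_eq_one {γ : Aff n} (h : γ.right = 1) (x v : Heis n) :
    fderiv ℝ (fun y : Heis n => γ • y) x v = leftL γ.left v := by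
  have : (fun y : Heis n => γ • y) = fun y => γ.left * y := by
    funext y; rw [smul_def, h, MulAut.one_apply]
  rw [this, (hasFDerivAt_mul_left _ x).fderiv]

theorem fderiv_smul_of_right_eq_tau {γ : Aff n} (h : γ.right = tau n) (x v : Heis n) :
    fderiv ℝ (fun y : Heis n => γ • y) x v = leftL γ.left (tau n v) := by
  have h1 : (fun y : Heis n => γ • y) = (fun y => γ.left * y) ∘ tauL n := by
    funext y; rw [smul_def, h, ← tauL_apply]; rfl
  rw [h1, ((hasFDerivAt_mul_left γ.left (tauL n x)).comp x (tauL n).hasFDerivAt).fderiv,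
    ← tauL_apply]
  rfl

theorem reForm_conj (z w : Fin n → ℂ) :
    reForm (fun i => conj (z i)) (fun i => conj (w i)) = reForm z w := by
  simp only [reForm_eq_sum]
  exact Finset.sum_congr rfl fun i _ => by simp

/-- The sign by which $\tau$ reverses $\omega_0$ occurs twice in $\omega_0\cdot\omega_0$, and
conjugation preserves $\operatorname{Re}({}^t\bar v w)$. So the metric descends although $\omega_0$
does not. -/
theorem metricCLM_smul [NeZero n] {γ : Aff n} (hγ : γ ∈ piGroup n) (x v w : Heis n) :
    metricCLM (γ • x) (fderiv ℝ (fun y : Heis n => γ • y) x v)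
      (fderiv ℝ (fun y : Heis n => γ • y) x w) = metricCLM x v w := by
  rw [metricCLM_apply, metricCLM_apply, smul_def]
  rcases piGroup_cases hγ with ⟨h, -⟩ | ⟨h, -⟩
  · rw [fderiv_smul_of_right_eq_one h, fderiv_smul_of_right_eq_one h, h, MulAut.one_apply,
      formCLM_leftL, formCLM_leftL, z_leftL, z_leftL]
  · rw [fderiv_smul_of_right_eq_tau h, fderiv_smul_of_right_eq_tau h, h,
      formCLM_leftL, formCLM_leftL, z_leftL, z_leftL, formCLM_tau, formCLM_tau, z_tau, z_tau,
      reForm_conj]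
    ring

local instance isManifold [NeZero n] : IsManifold 𝓘(ℝ, Heis n) ∞ (InfraNil n) :=
  SmoothQuotient.isManifold isSmoothAction

theorem isLocalDiffeomorph_proj [NeZero n] :
    IsLocalDiffeomorph 𝓘(ℝ, Heis n) 𝓘(ℝ, Heis n) ∞ (proj n) :=
  SmoothQuotient.isLocalDiffeomorph_mk isSmoothAction

theorem metricCLM_mfderiv_proj [NeZero n] (x v w : Heis n) :
    metricCLM (chartAt (Heis n) (proj n x) (proj n x))
      (mfderiv 𝓘(ℝ, Heis n) 𝓘(ℝ, Heis n) (proj n) x v)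
      (mfderiv 𝓘(ℝ, Heis n) 𝓘(ℝ, Heis n) (proj n) x w) = metricCLM x v w := by
  obtain ⟨g, hg, h⟩ := SmoothQuotient.exists_mfderiv_mk (isSmoothAction (n := n)) x
  have h1 : ∀ u : Heis n, modelDeriv (proj n) x u =
      fderiv ℝ (fun y : Heis n => (g : Aff n) • y) x u := fun u => DFunLike.congr_fun h u
  change metricCLM (chartAt (Heis n) (SmoothQuotient.mk (piGroup n) x)
    (SmoothQuotient.mk (piGroup n) x)) (modelDeriv (proj n) x v) (modelDeriv (proj n) x w) = _
  rw [← hg, h1, h1]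
  exact metricCLM_smul g.2 x v w

/-- The metric induced on `π \ N` by the Sasaki metric. -/
def quotientMetric (n : ℕ) [NeZero n] : RiemMetric (Heis n) (InfraNil n) where
  inner p := metricCLM (chartAt (Heis n) p p)
  symm p v w := metricCLM_symm _ v w
  pos p v hv := metricCLM_pos _ hv
  isVonNBounded p := isVonNBounded_metricCLM _
  contMDiff p := contMDiffAt_bilinear contDiff_metricCLM p fun y _ v w => by
    -- Inverse charts are the projection, so the metric reads as $g_0$ in every preferred chart.
    have h : ⇑(extChartAt 𝓘(ℝ, Heis n) p).symm = proj n := by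
      refine Eq.trans ?_ (SmoothQuotient.chartAt_symm p)
      simp
    rw [h]
    exact metricCLM_mfderiv_proj y v w

/-! #### Killing fields -/

/-- Solutions of $h'=c-ih$ are $h=-ic+Ce^{-is}$. Period $1$ forces $C=0$ because $1\notin2\pi\mathbb
Z$. The proof uses the first integral $e^{is}(h+ic)=C$. -/
theorem eq_of_periodic_of_hasDerivAt {h : ℝ → ℂ} {c : ℂ}
    (hd : ∀ s, HasDerivAt h (c - Complex.I * h s) s) (h1 : h 1 = h 0) (s : ℝ) : h s = h 0 := by
  let k : ℝ → ℂ := fun s => Complex.exp (s * Complex.I) * (h s + Complex.I * c)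
  have he : ∀ s : ℝ, HasDerivAt (fun s : ℝ => Complex.exp (s * Complex.I))
      (Complex.exp (s * Complex.I) * Complex.I) s := fun s => by
    have := ((hasDerivAt_id s).ofReal_comp.mul_const Complex.I).cexp
    simpa using this
  have hk : ∀ s, HasDerivAt k 0 s := fun s => by
    refine ((he s).mul ((hd s).add_const (Complex.I * c))).congr_deriv ?_
    linear_combination Complex.exp (s * Complex.I) * c * Complex.I_mul_I
  have hc : ∀ s, k s = k 0 := fun s =>
    is_const_of_deriv_eq_zero (fun s => (hk s).differentiableAt) (fun s => (hk s).deriv) s 0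
  have hI : Complex.exp Complex.I ≠ 1 := fun h => by
    obtain ⟨m, hm⟩ := Complex.exp_eq_one_iff.1 h
    have h2 := congrArg Complex.im hm
    simp at h2
    have h3 : (1 : ℝ) = m * (2 * Real.pi) := h2
    have h4 := Real.pi_gt_three
    rcases le_or_gt m 0 with hm0 | hm0
    · have : (m : ℝ) ≤ 0 := by exact_mod_cast hm0
      nlinarith
    · have : (1 : ℝ) ≤ m := by exact_mod_cast hm0
      nlinarith
  have h0 : h 0 + Complex.I * c = 0 := by
    have h2 := hc 1
    simp only [k, h1, Complex.ofReal_one, one_mul, Complex.ofReal_zero, zero_mul,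
      Complex.exp_zero] at h2
    have h3 : (Complex.exp Complex.I - 1) * (h 0 + Complex.I * c) = 0 := by
      rw [sub_mul, h2, one_mul, sub_self]
    exact (mul_eq_zero.1 h3).resolve_left (sub_ne_zero.2 hI)
  have hs := hc s
  simp only [k, h0, mul_zero] at hs
  have := (mul_eq_zero.1 hs).resolve_left (Complex.exp_ne_zero _)
  linear_combination this - h0

theorem reForm_add_left (a b c : Fin n → ℂ) : reForm (a + b) c = reForm a c + reForm b c := by
  simp only [← reFormL_apply, map_add, add_apply]

theorem reForm_sub_left (a b c : Fin n → ℂ) : reForm (a - b) c = reForm a c - reForm b c := by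
  simp only [← reFormL_apply, map_sub, sub_apply]

theorem reForm_I_smul_left (z w : Fin n → ℂ) : reForm (Complex.I • z) w = imForm z w := by
  simp only [imForm_eq_sum, reForm_eq_sum]
  exact Finset.sum_congr rfl fun i _ => by simp; ring

theorem eq_of_reForm {a b : Fin n → ℂ} (h : ∀ u, reForm a u = reForm b u) : a = b := by
  by_contra hne
  have h1 := reForm_self_pos (sub_ne_zero.2 hne)
  rw [reForm_sub_left, h, sub_self] at h1
  exact h1.false

/-- The $z$-components of $\Lambda$ contain the real basis $e_i$, $ie_i$ of $\mathbb C^n$. -/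
theorem eq_zero_of_reForm_lattice {w : Fin n → ℂ} (h : ∀ l ∈ lattice n, reForm l.z w = 0) :
    w = 0 := by
  have hmem : ∀ (i : Fin n) (b c : ℤ), mk 0 (Pi.single i (⟨b, c⟩ : ℂ)) ∈ lattice n :=
    fun i b c => ⟨⟨0, by simp⟩, fun j => by
      rw [z_mk]
      by_cases hj : j = i
      · subst hj; rw [Pi.single_eq_same]; exact ⟨⟨b, rfl⟩, ⟨c, rfl⟩⟩
      · rw [Pi.single_eq_of_ne hj]; exact ⟨⟨0, by simp⟩, ⟨0, by simp⟩⟩⟩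
  have hval : ∀ (i : Fin n) (b c : ℤ), (b : ℝ) * (w i).re + c * (w i).im = 0 := fun i b c => by
    have h1 := h _ (hmem i b c)
    rw [reForm_eq_sum, Finset.sum_eq_single i] at h1
    · simpa using h1
    · intro j _ hj
      simp [Pi.single_eq_of_ne hj]
    · simp
  funext i
  refine Complex.ext ?_ ?_
  · simpa using hval i 1 0
  · simpa using hval i 0 1

/-- The horizontal lift of `u` at `x`. -/
def lift (x : Heis n) (u : Fin n → ℂ) : Heis n := mk (-imForm x.z u) u

theorem z_lift (x : Heis n) (u : Fin n → ℂ) : (lift x u).z = u := rfl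

theorem formCLM_lift (x : Heis n) (u : Fin n → ℂ) : formCLM x (lift x u) = 0 := by
  rw [formCLM_apply, z_lift]; simp [lift]

/-- Because $\operatorname{Im}({}^t\bar u u)=0$, integral curves of horizontal lifts are straight
lines, so the horizontal equations can be integrated along affine lines. -/
theorem lift_add_smul_lift (x : Heis n) (u : Fin n → ℂ) (s : ℝ) :
    lift (x + s • lift x u) u = lift x u := by
  refine Heis.ext ?_ rfl
  simp [lift, imForm_add_left, imForm_smul_left, imForm_self]

theorem formCLM_inT (x : Heis n) (s : ℝ) : formCLM x (inT n s) = s := by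
  simp [formCLM_apply, inT_apply, imForm]

/-- There are no Killing fields of the Sasaki metric that are invariant under `π`. -/
theorem killing_eq_zero {V : Heis n → Heis n} (hV : Differentiable ℝ V)
    (hK : ∀ x v w : Heis n, fderiv ℝ metricCLM x (V x) v w + metricCLM x (fderiv ℝ V x v) w +
      metricCLM x v (fderiv ℝ V x w) = 0)
    (hz : ∀ l ∈ lattice n, ∀ x, (V (l * x)).z = (V x).z)
    (hf : ∀ l ∈ lattice n, ∀ x, formCLM (l * x) (V (l * x)) = formCLM x (V x))
    (hμ : ∀ x, formCLM (mu n • x) (V (mu n • x)) = -formCLM x (V x)) (x : Heis n) : V x = 0 := by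
  let f : Heis n → ℝ := fun y => formCLM y (V y)
  let ζ : Heis n → Fin n → ℂ := fun y => (V y).z
  have hfd : ∀ x, HasFDerivAt f (fderiv ℝ f x) x := fun x =>
    ((hasFDerivAt_formCLM x).clm_apply (hV x).hasFDerivAt).differentiableAt.hasFDerivAt
  have hζd : ∀ x, HasFDerivAt ζ (fderiv ℝ ζ x) x := fun x =>
    ((zL n).hasFDerivAt.comp x (hV x).hasFDerivAt).differentiableAt.hasFDerivAt
  have hζ : ∀ x v, (fderiv ℝ V x v).z = fderiv ℝ ζ x v := fun x v => z_fderiv (hV x) v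
  have hform : ∀ x v, formCLM x (fderiv ℝ V x v) = fderiv ℝ f x v + imForm (ζ x) v.z := fun x v => by
    have h1 := ((hasFDerivAt_formCLM x).clm_apply (hV x).hasFDerivAt).fderiv
    have h2 := DFunLike.congr_fun h1 v
    have h3 : fderiv ℝ f x v = formCLM x (fderiv ℝ V x v) + imForm v.z (ζ x) := by simpa using h2
    rw [h3, imForm_swap (ζ x) v.z]; ring
  -- The Killing equation in terms of $f$ and $\zeta$. The two equal contributions, from
  -- differentiating the metric and from $\omega_0(dV)$, produce the factor $2$ before `imForm`.
  -- Vertical–vertical, vertical–horizontal and horizontal–horizontal pairs then give `hT`, `hTH`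
  -- and `hHH`.
  have key : ∀ x v w, (fderiv ℝ f x v + 2 * imForm (ζ x) v.z) * formCLM x w +
      formCLM x v * (fderiv ℝ f x w + 2 * imForm (ζ x) w.z) +
      2 * reForm (fderiv ℝ ζ x v) w.z + 2 * reForm v.z (fderiv ℝ ζ x w) = 0 := fun x v w => by
    have h := hK x v w
    rw [fderiv_metricCLM, metricCLM_apply, metricCLM_apply, hform, hform, hζ, hζ] at h
    linear_combination h
  have zT : (inT n 1).z = 0 := rfl
  have re0 : ∀ z : Fin n → ℂ, reForm z 0 = 0 := fun z => by simp [reForm]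
  have re0' : ∀ z : Fin n → ℂ, reForm 0 z = 0 := fun z => by simp [reForm]
  have im0 : ∀ z : Fin n → ℂ, imForm z 0 = 0 := fun z => by simp [imForm]
  have hT : ∀ x, fderiv ℝ f x (inT n 1) = 0 := fun x => by
    have h := key x (inT n 1) (inT n 1)
    rw [formCLM_inT, zT, re0, re0', im0] at h
    linarith
  have hTH : ∀ x u, fderiv ℝ f x (lift x u) + 2 * imForm (ζ x) u +
      2 * reForm (fderiv ℝ ζ x (inT n 1)) u = 0 := fun x u => by
    have h := key x (inT n 1) (lift x u)
    rw [formCLM_inT, formCLM_lift, z_lift, zT, re0'] at h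
    linarith
  have hHH : ∀ x u, reForm u (fderiv ℝ ζ x (lift x u)) = 0 := fun x u => by
    have h := key x (lift x u) (lift x u)
    rw [formCLM_lift, z_lift, reForm_swap u] at h
    linarith
  have hline : ∀ (x v : Heis n) (s : ℝ), HasDerivAt (fun s : ℝ => x + s • v) v s := fun x v s => by
    simpa using ((hasDerivAt_id s).smul_const v).const_add x
  have hsT : ∀ s : ℝ, s • inT n 1 = inT n s := fun s => by rw [← map_smul]; simp
  have hft : ∀ x s, f (x + inT n s) = f x := fun x s => by
    have h1 : ∀ s, HasDerivAt (fun s : ℝ => f (x + s • inT n 1)) 0 s := fun s => by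
      have := (hfd (x + s • inT n 1)).comp_hasDerivAt s (hline x (inT n 1) s)
      rwa [hT] at this
    have := is_const_of_deriv_eq_zero (fun s => (h1 s).differentiableAt)
      (fun s => (h1 s).deriv) s 0
    simpa [hsT] using this
  have hft' : ∀ x s, fderiv ℝ f (x + inT n s) = fderiv ℝ f x := fun x s => by
    rw [← fderiv_comp_add_right]
    exact congrArg (fun F => fderiv ℝ F x) (funext fun y => hft y s)
  have hlt : ∀ x s u, lift (x + inT n s) u = lift x u := fun x s u => by
    simp [lift, inT_apply]
  have hinT : inT n 1 ∈ lattice n := ⟨⟨1, by simp [inT_apply]⟩, fun i =>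
    ⟨⟨0, by simp [inT_apply]⟩, ⟨0, by simp [inT_apply]⟩⟩⟩
  have hζt : ∀ x s, ζ (x + inT n s) = ζ x := fun x s => by
    -- By `hTH` this sum is determined by the horizontal derivative of $f$, which is constant along
    -- central lines. So each coordinate of $\zeta$ solves $h'=c-ih$ there, and the central lattice
    -- element $(1,0)$ supplies period $1$.
    set c := fderiv ℝ ζ x (inT n 1) + Complex.I • ζ x with hc
    have h1 : ∀ s, fderiv ℝ ζ (x + s • inT n 1) (inT n 1) =
        c - Complex.I • ζ (x + s • inT n 1) := fun s => by
      rw [hsT, eq_sub_iff_add_eq]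
      refine eq_of_reForm fun u => ?_
      have h2 := hTH (x + inT n s) u
      have h3 := hTH x u
      rw [hft', hlt] at h2
      rw [hc, reForm_add_left, reForm_add_left, reForm_I_smul_left, reForm_I_smul_left]
      linarith
    have h2 : ∀ s, HasDerivAt (fun s : ℝ => ζ (x + s • inT n 1))
        (c - Complex.I • ζ (x + s • inT n 1)) s := fun s => by
      have := (hζd (x + s • inT n 1)).comp_hasDerivAt s (hline x (inT n 1) s)
      rwa [h1] at this
    have h3 : ζ (x + inT n 1) = ζ x := by
      refine Eq.trans (congrArg ζ ?_) (hz _ hinT x)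
      refine Heis.ext ?_ ?_
      · simp [inT_apply, imForm, add_comm]
      · simp [inT_apply]
    funext i
    have h4 := eq_of_periodic_of_hasDerivAt (h := fun s : ℝ => ζ (x + s • inT n 1) i) (c := c i)
      (fun s => (hasDerivAt_pi.1 (h2 s)) i) (by simp [h3]) s
    simpa [hsT] using h4
  -- Any two points are joined by a horizontal segment followed by a central one; neither $f$ nor
  -- $\zeta$ changes along the latter.
  have hdiff : ∀ x y : Heis n, ∃ s, y = x + lift x (y.z - x.z) + inT n s := fun x y =>
    ⟨y.t - x.t + imForm x.z (y.z - x.z), Heis.ext (by simp [lift, inT_apply]; ring)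
      (by simp [lift, inT_apply])⟩
  have hP : ∀ x y, reForm (y.z - x.z) (ζ y - ζ x) = 0 := fun x y => by
    obtain ⟨s, hs⟩ := hdiff x y
    set u := y.z - x.z
    rw [hs, hζt, ← reFormL_apply, map_sub, sub_eq_zero]
    have h1 : ∀ s, HasDerivAt (fun s : ℝ => reFormL n u (ζ (x + s • lift x u))) 0 s := fun s => by
      have h2 := (hζd (x + s • lift x u)).comp_hasDerivAt s (hline x (lift x u) s)
      have h3 := (reFormL n u).hasFDerivAt.comp_hasDerivAt s h2
      have h4 := hHH (x + s • lift x u) u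
      rw [lift_add_smul_lift] at h4
      rwa [reFormL_apply, h4] at h3
    have := is_const_of_deriv_eq_zero (fun s => (h1 s).differentiableAt)
      (fun s => (h1 s).deriv) 1 0
    simpa using this
  -- Replacing `y` by `l * y` in `hP` keeps $\zeta(y)-\zeta(x)$ but adds $l_z$ to the displacement,
  -- so the difference is orthogonal to the lattice.
  have hζc : ∀ x y, ζ y = ζ x := fun x y => by
    rw [← sub_eq_zero]
    refine eq_zero_of_reForm_lattice fun l hl => ?_
    have h1 := hP x y
    have h2 := hP x (l * y)
    rw [show ζ (l * y) = ζ y from hz l hl y, z_mul, add_sub_assoc, reForm_add_left, h1] at h2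
    linarith
  have hζ0' : ∀ x v, fderiv ℝ ζ x v = 0 := fun x v => by
    have : ζ = fun _ => ζ x := funext fun y => hζc x y
    rw [this]; simp
  -- With $\zeta$ constant, `hTH` prescribes the derivative of $f$ along horizontal lines; integrate
  -- it over the segment.
  have hfl : ∀ x y, f y = f x - 2 * imForm (ζ x) (y.z - x.z) := fun x y => by
    obtain ⟨s, hs⟩ := hdiff x y
    set u := y.z - x.z
    rw [hs, hft]
    have h1 : ∀ s, HasDerivAt (fun s : ℝ => f (x + s • lift x u) + s * (2 * imForm (ζ x) u)) 0 s :=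
      fun s => by
        have h2 := (hfd (x + s • lift x u)).comp_hasDerivAt s (hline x (lift x u) s)
        have h3 := h2.add ((hasDerivAt_id s).mul_const (2 * imForm (ζ x) u))
        have h4 := hTH (x + s • lift x u) u
        rw [lift_add_smul_lift, hζ0', re0', hζc x] at h4
        exact h3.congr_deriv (by linarith)
    have := is_const_of_deriv_eq_zero (fun s => (h1 s).differentiableAt)
      (fun s => (h1 s).deriv) 1 0
    simp at this
    linarith
  -- A $\Lambda$-periodic affine function has zero linear part.
  have hζ0 : ζ x = 0 := by
    have h1 : Complex.I • ζ x = 0 := eq_zero_of_reForm_lattice fun l hl => by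
      have h2 := hfl x (l * x)
      rw [show f (l * x) = f x from hf l hl x, z_mul, add_sub_cancel_right] at h2
      rw [reForm_swap, reForm_I_smul_left]
      linarith
    exact (smul_eq_zero.1 h1).resolve_left Complex.I_ne_zero
  -- Now $f$ is constant, and $\mu$ changes its sign. Only here is an element outside $\Lambda$
  -- used.
  have hf0 : f x = 0 := by
    have h1 := hfl x (mu n • x)
    have h2 : f (mu n • x) = -f x := hμ x
    rw [h2, hζ0] at h1
    simp [imForm] at h1
    linarith
  exact eq_zero_of_form hf0 hζ0

/-- The infra-nilmanifold `π \ N` has no standard pseudo-Hermitian structure compatible with the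
metric induced by the Sasaki metric of `N`. -/
theorem not_isCompatible_quotientMetric [NeZero n]
    {η : (x : InfraNil n) → TangentSpace 𝓘(ℝ, Heis n) x →L[ℝ] ℝ}
    {J : (x : InfraNil n) → TangentSpace 𝓘(ℝ, Heis n) x →L[ℝ] TangentSpace 𝓘(ℝ, Heis n) x}
    {A : (x : InfraNil n) → TangentSpace 𝓘(ℝ, Heis n) x}
    (hS : IsStandardPseudoHermitian η J A) : ¬ IsCompatible (quotientMetric n) η J := by
  intro hg
  obtain ⟨φ, hφ, h0, hadd, hA, hP⟩ := hS.flow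
  have hq := isLocalDiffeomorph_proj (n := n)
  let D := hq.mfderivToContinuousLinearEquiv (by simp)
  let V : Heis n → Heis n := fun x => (D x).symm (A (proj n x))
  have hV : ∀ x : Heis n, mfderiv 𝓘(ℝ, Heis n) 𝓘(ℝ, Heis n) (proj n) x (V x) = A (proj n x) :=
    fun x => (D x).apply_symm_apply _
  obtain ⟨hVd, hK⟩ := killing_of_isometries hq hφ h0 hA
    (inner_flow hS.toIsPseudoHermitian hg hφ h0 hadd hA hP hq)
    (contDiff_metricCLM.differentiable (by simp)) metricCLM_mfderiv_proj hV
  -- Both sides project to the Reeb vector at the same point of the quotient, and the differential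
  -- of the projection is injective.
  have hequiv : ∀ γ ∈ piGroup n, ∀ x : Heis n,
      V (γ • x) = fderiv ℝ (fun y : Heis n => γ • y) x (V x) := fun γ hγ x => by
    let A' : InfraNil n → Heis n := A
    have h1 : modelDeriv (proj n) (γ • x) (V (γ • x)) = A' (proj n (γ • x)) := hV (γ • x)
    have h2 : modelDeriv (proj n) (γ • x) (fderiv ℝ (fun y : Heis n => γ • y) x (V x)) =
        A' (proj n x) :=
      (SmoothQuotient.mfderiv_mk_smul isSmoothAction (⟨γ, hγ⟩ : piGroup n) x (V x)).trans (hV x)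
    have h3 : proj n (γ • x) = proj n x :=
      SmoothQuotient.mk_smul (⟨γ, hγ⟩ : piGroup n) x
    rw [h3, ← h2] at h1
    exact (D (γ • x)).injective h1
  have hl : ∀ l ∈ lattice n, ∀ x, V (l * x) = leftL l (V x) := fun l hl x => by
    have h := hequiv _ (latticeAff_le ⟨l, hl, rfl⟩) x
    rwa [fderiv_smul_of_right_eq_one rfl] at h
  have hμ : ∀ x, V (mu n • x) = leftL (alpha n (1 / 2)) (tau n (V x)) := fun x => by
    rw [hequiv _ mu_mem x, fderiv_smul_of_right_eq_tau right_mu, left_mu]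
  have hV0 := killing_eq_zero hVd hK
    (fun l hl' x => by rw [hl l hl', z_leftL])
    (fun l hl' x => by rw [hl l hl', formCLM_leftL])
    (fun x => by rw [hμ, smul_def, left_mu, right_mu, formCLM_leftL, formCLM_tau]) 0
  -- The contradiction: the lift vanishes at the origin, hence so does the Reeb field below it, yet
  -- $\hat\eta$ equals $1$ on that field.
  have hA0 := hS.form_reeb (proj n 0)
  rw [← hV 0, hV0] at hA0
  have : η (proj n 0) (mfderiv 𝓘(ℝ, Heis n) 𝓘(ℝ, Heis n) (proj n) 0
    (0 : TangentSpace 𝓘(ℝ, Heis n) (0 : Heis n))) = 0 := by rw [map_zero, map_zero]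
  exact zero_ne_one (this.symm.trans hA0)

end Heis

end

open SasakiGeometry in
/-- For every `n ≥ 1`, the quotient `π \ N` of the Heisenberg group `N = ℝ × ℂⁿ` is a compact
infra-nilmanifold whose metric `ĝ₀` is locally the Sasaki metric `g₀` of `N`, but it carries no
Sasaki structure compatible with `ĝ₀`, even if the complex structure is not required to be
integrable. -/
theorem mainTheorem11 (n : ℕ) (hn : 1 ≤ n) :
    -- `N` is a simply connected nilpotent Lie group, and `{ω₀, J}` is a Sasaki structure on it
    LieGroup 𝓘(ℝ, Heis n) ∞ (Heis n) ∧ SimplyConnectedSpace (Heis n) ∧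
    Group.IsNilpotent (Heis n) ∧
    IsSasaki (M := Heis n) Heis.form Heis.complexStr Heis.reeb ∧
    -- `τ` is an anti-pseudo-Hermitian automorphism of order two
    orderOf (Heis.tau n) = 2 ∧
    ReversesPsh (M := Heis n) Heis.form Heis.complexStr (Heis.tau n) ∧
    -- `π` is a torsion-free extension of `ℤ / 2` by `Λ`, contained in `N ⋊ ⟨τ⟩`
    (∀ γ ∈ Heis.piGroup n, γ.right ∈ Subgroup.zpowers (Heis.tau n)) ∧
    Heis.latticeAff n ≤ Heis.piGroup n ∧ (Heis.latticeAff n).relIndex (Heis.piGroup n) = 2 ∧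
    (∀ γ ∈ Heis.piGroup n, γ ≠ 1 → ¬ IsOfFinOrder γ) ∧
    -- `π` acts freely and properly discontinuously, so that `π \ N` gets charts from `N`
    ∃ (_ : ContinuousConstSMul (Heis.piGroup n) (Heis n))
      (_ : ProperlyDiscontinuousSMul (Heis.piGroup n) (Heis n))
      (_ : IsCancelSMul (Heis.piGroup n) (Heis n)),
    -- with these charts `π \ N` is a closed smooth manifold, locally diffeomorphic to `N`
    CompactSpace (Heis.InfraNil n) ∧ T2Space (Heis.InfraNil n) ∧
    ∃ (_ : IsManifold 𝓘(ℝ, Heis n) ∞ (Heis.InfraNil n)),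
    IsLocalDiffeomorph 𝓘(ℝ, Heis n) 𝓘(ℝ, Heis n) ∞ (Heis.proj n) ∧
    -- the Sasaki metric `g₀` of `N` induces a metric `ĝ₀` on `π \ N`
    ∃ (g₀ : RiemMetric (Heis n) (Heis n)) (g : RiemMetric (Heis n) (Heis.InfraNil n)),
    IsCompatible g₀ Heis.form Heis.complexStr ∧
    (∀ (x : Heis n) (v w : TangentSpace 𝓘(ℝ, Heis n) x),
      g.inner (Heis.proj n x)
        (mfderiv 𝓘(ℝ, Heis n) 𝓘(ℝ, Heis n) (Heis.proj n) x v)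
        (mfderiv 𝓘(ℝ, Heis n) 𝓘(ℝ, Heis n) (Heis.proj n) x w) = g₀.inner x v w) ∧
    -- there is no compatible Sasaki structure on `(π \ N, ĝ₀)`
    ¬ ∃ (η : (x : Heis.InfraNil n) → TangentSpace 𝓘(ℝ, Heis n) x →L[ℝ] ℝ)
        (J : (x : Heis.InfraNil n) →
          TangentSpace 𝓘(ℝ, Heis n) x →L[ℝ] TangentSpace 𝓘(ℝ, Heis n) x)
        (A : (x : Heis.InfraNil n) → TangentSpace 𝓘(ℝ, Heis n) x),
        IsStandardPseudoHermitian η J A ∧ IsCompatible g η J := by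
  have : NeZero n := ⟨by omega⟩
  exact ⟨Heis.lieGroup n, Heis.simplyConnectedSpace n, Heis.isNilpotent n, Heis.isSasaki n,
    Heis.orderOf_tau, Heis.reversesPsh_tau n, fun _ => Heis.right_mem_zpowers,
    Heis.latticeAff_le, Heis.relIndex_latticeAff,
    fun _ hγ hne hf => hne (Heis.eq_one_of_isOfFinOrder hγ hf),
    Heis.continuousConstSMul, Heis.properlyDiscontinuousSMul, Heis.isCancelSMul,
    Heis.compactSpace_infraNil n,
    Heis.t2Space_infraNil, Heis.isManifold, Heis.isLocalDiffeomorph_proj,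
    Heis.metric n, Heis.quotientMetric n, Heis.isCompatible_metric n,
    Heis.metricCLM_mfderiv_proj, fun ⟨_, _, _, hS, hC⟩ =>
      Heis.not_isCompatible_quotientMetric hS hC⟩
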